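/- For $N\ge 1$ and $k\ge 0$ let $M_k(N)$ be the complex vector space of modular forms of weight $k$ for $\Gamma_0(N)$, and let $M(N)=\bigoplus_{k\ge 0}M_k(N)$ be the graded ring of modular forms. Modular forms are identified with their Fourier expansions in $q=e^{2\pi i z}$. For even $k>0$ put $E_k=1-\frac{2k}{B_k}\sum_{n\ge1}\sigma_{k-1}(n)q^n$, where $B_k$ is the $k$-th Bernoulli number and $\sigma_k(n)=\sum_{d\mid n}d^k$. Write $f^{(h)}(q)=f(q^h)$. Put $C_N=\frac{1}{\gcd(N-1,24)}\bigl(N E_2^{(N)}-E_2\bigr)$ for $N>1$ and $\alpha_p=\frac1{240}(E_4-E_4^{(p)})$ for $p$ prime. Let $\rho_3$ be the non-trivial Dirichlet character modulo $3$ and $E_{\rho_3}=\sum_{n\ge1}\Bigl(\sum_{d\mid n}\rho_3(d)^2d\Bigr)\rho_3(n)q^n$. Put $$\beta_3=\tfrac1{12}\bigl(\tfrac1{504}(E_6^{(3)}-E_6)-C_3\alpha_3\bigr),\qquad \beta_5=\tfrac1{36}\bigl(-C_5^2+12\alpha_5+E_4^{(5)}\bigr),$$ $$\alpha_6=\tfrac1{12}(C_2-C_3),\qquad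 \beta_6=\tfrac1{12}\bigl(C_3^{(2)}-C_2^{(3)}\bigr),\qquad \alpha_4=\tfrac1{16}(C_2-C_4),$$ $$\beta_9=\tfrac16\bigl(\tfrac19(C_3-C_9)-E_{\rho_3}\bigr),\qquad \alpha_9=E_{\rho_3}+9\beta_9 .$$ Theorem 2. For each $N\in\{3,5,6,8,9\}$ the three series $f_0,f_1,f_2$ listed below are $q$-expansions of elements of $M(N)$, homogeneous of the indicated weights $[n_0,n_1,n_2]$. If $\mathbb C[X_0,X_1,X_2]^{[n_0,n_1,n_2]}$ denotes the polynomial ring graded by giving $X_i$ weight $n_i$, then $X_i\mapsto f_i$ induces an isomorphism of graded $\mathbb C$-algebras $\mathbb C[X_0,X_1,X_2]^{[n_0,n_1,n_2]}/(O_N)\simeq M(N)$, that is (writing $f_i$ for $X_i$): $$M(3)\simeq\mathbb C[C_3,\alpha_3,\beta_3]^{[2,4,6]}/(\alpha_3^2-C_3\beta_3),$$ $$M(5)\simeq\mathbb C[C_5,\alpha_5,\beta_5]^{[2,4,4]}/\bigl(\alpha_5^2-(C_5^2+4\alpha_5-8\beta_5)\beta_5\bigr),$$ $$M(6)\simeq\mathbb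 C[C_3^{(2)},\alpha_6,\beta_6]^{[2,2,2]}/(\alpha_6^2-C_3^{(2)}\beta_6),$$ $$M(8)\simeq\mathbb C[C_4^{(2)},\alpha_4,\alpha_4^{(2)}]^{[2,2,2]}/(\alpha_4^2-C_4^{(2)}\alpha_4^{(2)}),$$ $$M(9)\simeq\mathbb C[C_3,\alpha_9,\beta_9]^{[2,2,2]}/(\alpha_9^2-C_3\beta_9).$$ -/

import Mathlib

open scoped DirectSum PowerSeries

namespace SmallLevel

noncomputable section

/-- `Mk N k` is the complex vector space of modular forms of weight `k ≥ 0` for `Γ₀(N)`. -/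
abbrev Mk (N k : ℕ) : Type :=
  ModularForm ((CongruenceSubgroup.Gamma0 N).map (Matrix.SpecialLinearGroup.mapGL ℝ)) (k : ℤ)

/-- Modular forms of (propositionally) equal weights that agree as functions are equal as elements
of the graded monoid. -/
theorem gradedMonoid_ext {N : ℕ} {a b : GradedMonoid (Mk N)} (h : a.1 = b.1)
    (h2 : ∀ z, a.2 z = b.2 z) : a = b := by
  obtain ⟨i, a⟩ := a
  obtain ⟨j, b⟩ := b
  obtain rfl : i = j := h
  exact congrArg (Sigma.mk i) (ModularForm.ext h2)

instance (N : ℕ) : GradedMonoid.GOne (Mk N) where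
  one := ModularForm.mcast (by simp) (1 : ModularForm _ 0)

instance (N : ℕ) : GradedMonoid.GMul (Mk N) where
  mul f g := ModularForm.mcast (by push_cast; rfl) (f.mul g)

/-- The multiplication on `⨁ k, Mk N k` is the pointwise product of modular forms. -/
instance (N : ℕ) : DirectSum.GCommRing (Mk N) where
  one_mul _ := gradedMonoid_ext (zero_add _) fun _ => one_mul _
  mul_one _ := gradedMonoid_ext (add_zero _) fun _ => mul_one _
  mul_assoc _ _ _ := gradedMonoid_ext (add_assoc _ _ _) fun _ => mul_assoc _ _ _
  mul_zero {_ _} _ := ModularForm.ext fun _ => mul_zero _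
  zero_mul {_ _} _ := ModularForm.ext fun _ => zero_mul _
  mul_add {_ _} _ _ _ := ModularForm.ext fun _ => mul_add _ _ _
  add_mul {_ _} _ _ _ := ModularForm.ext fun _ => add_mul _ _ _
  mul_comm _ _ := gradedMonoid_ext (add_comm _ _) fun _ => mul_comm _ _
  natCast n := ModularForm.mcast (by simp) (n : ModularForm _ 0)
  natCast_zero := ModularForm.ext fun _ => Nat.cast_zero
  natCast_succ _ := ModularForm.ext fun _ => Nat.cast_succ _
  intCast n := ModularForm.mcast (by simp) (n : ModularForm _ 0)
  intCast_ofNat _ := ModularForm.ext fun _ => AddGroupWithOne.intCast_ofNat _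
  intCast_negSucc_ofNat _ := ModularForm.ext fun _ => AddGroupWithOne.intCast_negSucc _

/-- Complex scalars sit in weight `0` as constant functions. -/
instance (N : ℕ) : DirectSum.GAlgebra ℂ (Mk N) where
  toFun :=
    { toFun := fun z => ModularForm.mcast (by simp) (ModularForm.const z : ModularForm _ 0)
      map_zero' := rfl
      map_add' := fun _ _ => rfl }
  map_one := rfl
  map_mul _ _ := gradedMonoid_ext (zero_add 0).symm fun _ => rfl
  commutes _ _ := gradedMonoid_ext (add_comm _ _) fun _ => mul_comm _ _
  smul_def _ _ := gradedMonoid_ext (zero_add _).symm fun _ => rfl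

/-- The graded ring `M(N) = ⨁_{k ≥ 0} M_k(N)` of modular forms for `Γ₀(N)`. -/
abbrev M (N : ℕ) : Type := ⨁ k : ℕ, Mk N k

/-! ### The explicit `q`-series -/

/-- `E_k = 1 - (2k / B_k) ∑_{n ≥ 1} σ_{k-1}(n) q^n`. -/
def E (k : ℕ) : ℂ⟦X⟧ :=
  PowerSeries.mk fun n =>
    if n = 0 then 1
    else -(2 * k / (bernoulli k : ℂ)) * (ArithmeticFunction.sigma (k - 1) n : ℂ)

/-- `V h f = f^{(h)}`, that is `f(q^h)`, the coefficient of `q^n` being that of `q^(n/h)` in `f`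
if `h ∣ n`, and `0` otherwise. -/
def V (h : ℕ) (f : ℂ⟦X⟧) : ℂ⟦X⟧ :=
  PowerSeries.mk fun n => if h ∣ n then PowerSeries.coeff (n / h) f else 0

/-- `C_N = (N E_2^{(N)} - E_2) / gcd(N - 1, 24)`, for `N > 1`. -/
def eisC (N : ℕ) : ℂ⟦X⟧ := (1 / (Nat.gcd (N - 1) 24 : ℂ)) • ((N : ℂ) • V N (E 2) - E 2)

/-- `α_p = (E_4 - E_4^{(p)}) / 240`, for `p` prime. -/
def alphaPrime (p : ℕ) : ℂ⟦X⟧ := (1 / 240 : ℂ) • (E 4 - V p (E 4))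

/-- `σ_χ(n) = ∑_{d ∣ n} χ(d) d`. -/
def sigmaChar {m : ℕ} (χ : DirichletCharacter ℂ m) (n : ℕ) : ℂ :=
  ∑ d ∈ n.divisors, χ (d : ZMod m) * (d : ℂ)

/-- `E_χ = ∑_{n ≥ 1} σ_{χ²}(n) conj(χ(n)) q^n`. -/
def EChar {m : ℕ} (χ : DirichletCharacter ℂ m) : ℂ⟦X⟧ :=
  PowerSeries.mk fun n =>
    if n = 0 then 0 else sigmaChar (χ ^ 2) n * (starRingEnd ℂ) (χ (n : ZMod m))

/-- The non-trivial real Dirichlet character modulo `3`. -/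
def rho3 : DirichletCharacter ℂ 3 := (quadraticChar (ZMod 3)).ringHomComp (Int.castRingHom ℂ)

def alpha3 : ℂ⟦X⟧ := alphaPrime 3

def beta3 : ℂ⟦X⟧ := (1 / 12 : ℂ) • ((1 / 504 : ℂ) • (V 3 (E 6) - E 6) - eisC 3 * alpha3)

def alpha5 : ℂ⟦X⟧ := alphaPrime 5

def beta5 : ℂ⟦X⟧ := (1 / 36 : ℂ) • (-(eisC 5) ^ 2 + (12 : ℂ) • alpha5 + V 5 (E 4))

def alpha6 : ℂ⟦X⟧ := (1 / 12 : ℂ) • (eisC 2 - eisC 3)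

def beta6 : ℂ⟦X⟧ := (1 / 12 : ℂ) • (V 2 (eisC 3) - V 3 (eisC 2))

def alpha4 : ℂ⟦X⟧ := (1 / 16 : ℂ) • (eisC 2 - eisC 4)

def beta9 : ℂ⟦X⟧ := (1 / 6 : ℂ) • ((1 / 9 : ℂ) • (eisC 3 - eisC 9) - EChar rho3)

def alpha9 : ℂ⟦X⟧ := EChar rho3 + (9 : ℂ) • beta9

/-! ### Graded presentations -/

/-- `HasGradedPresentation N w F O` says that

* each power series `F i` is the `q`-expansion (in `q = exp(2πiz)`) of some `f i ∈ M_{w i}(N)`, and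
* `X_i ↦ f i` induces an isomorphism of `ℂ`-algebras `ℂ[X_0, X_1, X_2] / (O) ≃ M(N)` which is
  graded: it carries the weight `k` part of the quotient (the image of the polynomials that are
  weighted homogeneous of degree `k`, where `X_i` has weight `w i`) onto `M_k(N)`, for every `k`. -/
def HasGradedPresentation (N : ℕ) (w : Fin 3 → ℕ) (F : Fin 3 → ℂ⟦X⟧)
    (O : MvPolynomial (Fin 3) ℂ) : Prop :=
  ∃ f : (i : Fin 3) → Mk N (w i),
    (∀ i, UpperHalfPlane.qExpansion 1 (f i) = F i) ∧
    ∃ e : (MvPolynomial (Fin 3) ℂ ⧸ Ideal.span {O}) ≃ₐ[ℂ] M N,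
      (∀ i, e (Ideal.Quotient.mk (Ideal.span {O}) (MvPolynomial.X i)) =
        DirectSum.of (Mk N) (w i) (f i)) ∧
      ∀ k : ℕ,
        ((MvPolynomial.weightedHomogeneousSubmodule ℂ w k).map
          (Ideal.Quotient.mkₐ ℂ (Ideal.span {O})).toLinearMap).map e.toLinearMap =
        LinearMap.range (DirectSum.lof ℂ ℕ (Mk N) k)

end

end SmallLevel

/-!
Let `w` be the weights of the generators `F 0 = 1 + ⋯`, `F 1 = q + ⋯`, `F 2 = q² + ⋯`. In all five
cases the relation `O` is monic of degree `2` in `X 1`, so that the standard monomials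
`X 0 ^ a * X 1 ^ ε * X 2 ^ b` with `ε ∈ {0, 1}` span the polynomial ring modulo `O`
(`exists_sub_mem_stdSpan`). Evaluated at the `F i`, such a monomial has order `ε + 2 b` at infinity
and leading coefficient `1`; as the order determines `ε` and `b`, the standard monomials of a given
weight have distinct orders and remain linearly independent
(`linearIndependent_evalForms_stdMonomial`).

All that remains to be known about `M(N)` is that the order of a nonzero form is always the order of
a standard monomial of the same weight (`OrdersAreStandard`). Then subtracting leading terms shows
that the standard monomials generate `M(N)` (`lof_mem_map_evalForms`), and the relation holds as soon
as its first few coefficients vanish; see `hasGradedPresentation_of_ordersAreStandard`.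

The statement on orders is the Sturm bound `12 n ≤ k [SL(2, ℤ) : Γ₀(N)]` (`exists_order_qExp_eq`),
which is obtained from level one through the norm of a form: the `q`-expansion of a form divides that
of its norm (`qExp_dvd_qExpansion_norm`). At level `5` and weight `k ≡ 2` modulo `4` the bound is one
too large. There every form vanishes at the elliptic point `(2 + i) / 5`, whereas a form that attains
the bound has a norm proportional to a power of `Δ`, without zeros
(`order_qExp_lt_of_apply_eq_zero`).

The generators are modular because `E₂(z) - 3 / (π Im z)` is `SL(2, ℤ)`-invariant of weight `2` and
its non-holomorphic part is not changed by substitutions `z ↦ a z + b`; hence differences of the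
transforms of `E₂` under such substitutions are modular forms for every `Γ₀(N)` that they conjugate
into `SL(2, ℤ)` (`exists_modularForm_E2_sub`). This covers the dilations by divisors of `N`, and the
translations by thirds at level `9`, from which the twist `E_ρ` is made. The dilations of `E₄` and
`E₆` are modular for the same reason (`exists_modularForm_slash`).
-/

namespace SmallLevel

noncomputable section

/-! ### The `q`-expansion homomorphism and polynomials in modular forms -/

section Presentation

open MvPolynomial UpperHalfPlane

theorem one_mem_strictPeriods_Gamma0 (N : ℕ) :
    (1 : ℝ) ∈ ((CongruenceSubgroup.Gamma0 N).map
      (Matrix.SpecialLinearGroup.mapGL ℝ)).strictPeriods := by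
  rw [CongruenceSubgroup.strictPeriods_Gamma0]
  exact AddSubgroup.mem_zmultiples 1

/-- The `q`-expansion as a linear map on `M_k(N)`. -/
def qExp (N k : ℕ) : Mk N k →ₗ[ℂ] ℂ⟦X⟧ where
  toFun f := qExpansion 1 f
  map_add' f g := ModularForm.qExpansion_add one_pos (one_mem_strictPeriods_Gamma0 N) f g
  map_smul' c f := ModularForm.qExpansion_smul one_pos (one_mem_strictPeriods_Gamma0 N) c f

theorem qExp_apply {N k : ℕ} (f : Mk N k) : qExp N k f = qExpansion 1 f := rfl

theorem qExp_eq_zero_iff {N k : ℕ} {f : Mk N k} : qExp N k f = 0 ↔ f = 0 :=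
  ModularForm.qExpansion_eq_zero_iff one_pos (one_mem_strictPeriods_Gamma0 N) f

/-- The `q`-expansion as an algebra homomorphism on the whole graded ring `M(N)`. It is injective
on each `M_k(N)`. -/
def qExpHom (N : ℕ) : M N →ₐ[ℂ] ℂ⟦X⟧ :=
  DirectSum.toAlgebra ℂ (Mk N) (qExp N)
    (ModularForm.qExpansion_one
      (Γ := (CongruenceSubgroup.Gamma0 N).map (Matrix.SpecialLinearGroup.mapGL ℝ)))
    fun f g ↦ ModularForm.qExpansion_mul one_pos (one_mem_strictPeriods_Gamma0 N) f g

@[simp]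
theorem qExpHom_of {N k : ℕ} (f : Mk N k) : qExpHom N (DirectSum.of (Mk N) k f) = qExp N k f :=
  DirectSum.toAddMonoid_of (fun k ↦ (qExp N k).toAddMonoidHom) k f

theorem one_mem_range_lof (N : ℕ) : (1 : M N) ∈ LinearMap.range (DirectSum.lof ℂ ℕ (Mk N) 0) :=
  ⟨GradedMonoid.GOne.one, rfl⟩

theorem mul_mem_range_lof {N a b : ℕ} {x y : M N}
    (hx : x ∈ LinearMap.range (DirectSum.lof ℂ ℕ (Mk N) a))
    (hy : y ∈ LinearMap.range (DirectSum.lof ℂ ℕ (Mk N) b)) :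
    x * y ∈ LinearMap.range (DirectSum.lof ℂ ℕ (Mk N) (a + b)) := by
  obtain ⟨f, rfl⟩ := hx
  obtain ⟨g, rfl⟩ := hy
  exact ⟨_, (DirectSum.of_mul_of f g).symm⟩

theorem pow_mem_range_lof {N a : ℕ} {x : M N}
    (hx : x ∈ LinearMap.range (DirectSum.lof ℂ ℕ (Mk N) a)) (n : ℕ) :
    x ^ n ∈ LinearMap.range (DirectSum.lof ℂ ℕ (Mk N) (n * a)) := by
  induction n with
  | zero => rw [pow_zero, Nat.zero_mul]; exact one_mem_range_lof N
  | succ n ih => rw [pow_succ, Nat.succ_mul]; exact mul_mem_range_lof ih hx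

variable {N : ℕ} {w : Fin 3 → ℕ} (f : (i : Fin 3) → Mk N (w i))

/-- The algebra homomorphism `ℂ[X_0, X_1, X_2] → M(N)`, `X_i ↦ f_i`. -/
def evalForms : MvPolynomial (Fin 3) ℂ →ₐ[ℂ] M N :=
  aeval fun i ↦ DirectSum.of (Mk N) (w i) (f i)

theorem evalForms_mem_range_lof {p : MvPolynomial (Fin 3) ℂ} {k : ℕ}
    (hp : IsWeightedHomogeneous w p k) :
    evalForms f p ∈ LinearMap.range (DirectSum.lof ℂ ℕ (Mk N) k) := by
  rw [p.as_sum, map_sum]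
  refine Submodule.sum_mem _ fun d hd ↦ ?_
  have hk := hp (mem_support_iff.mp hd)
  rw [evalForms, aeval_monomial, ← Algebra.smul_def]
  refine Submodule.smul_mem _ _ ?_
  rw [Finsupp.prod_fintype _ _ (by simp), Fin.prod_univ_three]
  have h3 : d 0 * w 0 + d 1 * w 1 + d 2 * w 2 = k := by
    rw [← hk, Finsupp.weight_apply, Finsupp.sum_fintype _ _ (by simp), Fin.sum_univ_three]
    simp
  rw [← h3]
  exact mul_mem_range_lof (mul_mem_range_lof (pow_mem_range_lof ⟨f 0, rfl⟩ _)
    (pow_mem_range_lof ⟨f 1, rfl⟩ _)) (pow_mem_range_lof ⟨f 2, rfl⟩ _)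

variable {F : Fin 3 → ℂ⟦X⟧}

theorem qExpHom_evalForms (hf : ∀ i, qExpansion 1 (f i) = F i) (p : MvPolynomial (Fin 3) ℂ) :
    qExpHom N (evalForms f p) = aeval F p := by
  have : (qExpHom N).comp (evalForms f) = aeval F := by
    refine MvPolynomial.algHom_ext fun i ↦ ?_
    rw [AlgHom.comp_apply, evalForms, aeval_X, aeval_X, qExpHom_of, qExp_apply, hf]
  exact DFunLike.congr_fun this p

/-! ### Standard monomials -/

/-- Indices `(a, ε, b)` of the standard monomials `X_0 ^ a X_1 ^ ε X_2 ^ b`, `ε ∈ {0, 1}`, which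
represent a basis modulo a relation that is monic of degree `2` in `X_1`. -/
abbrev StdIndex : Type := ℕ × Fin 2 × ℕ

/-- The standard monomial `X_0 ^ a X_1 ^ ε X_2 ^ b`. -/
def stdMonomial (s : StdIndex) : MvPolynomial (Fin 3) ℂ :=
  X 0 ^ s.1 * X 1 ^ (s.2.1 : ℕ) * X 2 ^ s.2.2

/-- The weight of a standard monomial. -/
def stdWeight (w : Fin 3 → ℕ) (s : StdIndex) : ℕ := s.1 * w 0 + s.2.1 * w 1 + s.2.2 * w 2

/-- The order at `q = 0` of a standard monomial evaluated at series of orders `0, 1, 2`. -/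
def stdOrder (s : StdIndex) : ℕ := s.2.1 + 2 * s.2.2

theorem stdMonomial_isWeightedHomogeneous (s : StdIndex) :
    IsWeightedHomogeneous w (stdMonomial s) (stdWeight w s) := by
  have h (i : Fin 3) (n : ℕ) : IsWeightedHomogeneous w (X i ^ n : MvPolynomial (Fin 3) ℂ)
      (n * w i) := by
    simpa using (isWeightedHomogeneous_X ℂ w i).pow n
  exact ((h 0 _).mul (h 1 _)).mul (h 2 _)

/-- The series `F_0, F_1, F_2` start with `1`, `q`, `q ^ 2` respectively. -/
structure HasLeadingTerms (F : Fin 3 → ℂ⟦X⟧) : Prop where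
  coeff_zero : PowerSeries.coeff 0 (F 0) = 1
  order_one : ∃ G, F 1 = PowerSeries.X * G ∧ PowerSeries.coeff 0 G = 1
  order_two : ∃ G, F 2 = PowerSeries.X ^ 2 * G ∧ PowerSeries.coeff 0 G = 1

theorem HasLeadingTerms.aeval_stdMonomial (hF : HasLeadingTerms F) (s : StdIndex) :
    ∃ G : ℂ⟦X⟧, aeval F (stdMonomial s) = PowerSeries.X ^ stdOrder s * G ∧
      PowerSeries.coeff 0 G = 1 := by
  obtain ⟨h0, ⟨G1, h1, h1'⟩, G2, h2, h2'⟩ := hF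
  refine ⟨F 0 ^ s.1 * G1 ^ (s.2.1 : ℕ) * G2 ^ s.2.2, ?_, ?_⟩
  · simp only [stdMonomial, map_mul, map_pow, aeval_X, h1, h2, stdOrder]
    ring
  · simp only [PowerSeries.coeff_zero_eq_constantCoeff, map_mul, map_pow] at h0 h1' h2' ⊢
    simp [h0, h1', h2']

theorem HasLeadingTerms.coeff_aeval_stdMonomial (hF : HasLeadingTerms F) (s : StdIndex) :
    PowerSeries.coeff (stdOrder s) (aeval F (stdMonomial s)) = 1 := by
  obtain ⟨G, h, h'⟩ := hF.aeval_stdMonomial s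
  rw [h, PowerSeries.coeff_X_pow_mul', if_pos le_rfl, Nat.sub_self, h']

theorem HasLeadingTerms.coeff_aeval_stdMonomial_of_lt (hF : HasLeadingTerms F) (s : StdIndex)
    {n : ℕ} (hn : n < stdOrder s) : PowerSeries.coeff n (aeval F (stdMonomial s)) = 0 := by
  obtain ⟨G, h, -⟩ := hF.aeval_stdMonomial s
  rw [h, PowerSeries.coeff_X_pow_mul', if_neg (by omega)]

/-- Within a fixed weight, the order determines the standard monomial. -/
theorem stdIndex_ext (h0 : 0 < w 0) {s t : StdIndex} (hw : stdWeight w s = stdWeight w t)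
    (ho : stdOrder s = stdOrder t) : s = t := by
  obtain ⟨a, e, b⟩ := s
  obtain ⟨a', e', b'⟩ := t
  simp only [stdOrder] at ho
  obtain rfl : e = e' := Fin.ext (by omega)
  obtain rfl : b = b' := by omega
  have : a * w 0 = a' * w 0 := by simpa [stdWeight] using hw
  rw [Nat.eq_of_mul_eq_mul_right h0 this]

/-- A polynomial combination of standard monomials which vanishes in `M(N)` is trivial: look at a
monomial of minimal order among those that occur, and at its weight component. -/
theorem linearIndependent_evalForms_stdMonomial (h0 : 0 < w 0)
    (hf : ∀ i, qExpansion 1 (f i) = F i) (hF : HasLeadingTerms F) :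
    LinearIndependent ℂ fun s ↦ evalForms f (stdMonomial s) := by
  choose g hg using fun s : StdIndex ↦
    evalForms_mem_range_lof f (stdMonomial_isWeightedHomogeneous s)
  have hq (s) : qExp N _ (g s) = aeval F (stdMonomial s) := by
    rw [← qExpHom_evalForms f hf, ← hg s]
    exact (qExpHom_of _).symm
  rw [linearIndependent_iff]
  intro l hl
  by_contra hne
  obtain ⟨s, hs, hmin⟩ := l.support.exists_min_image stdOrder (Finsupp.support_nonempty_iff.mpr hne)
  have h1 := congrArg (fun x ↦ PowerSeries.coeff (stdOrder s)
    (qExp N _ (DirectSum.component ℂ ℕ (Mk N) (stdWeight w s) x))) hl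
  simp only [Finsupp.linearCombination_apply, Finsupp.sum, map_sum, map_smul, map_zero] at h1
  rw [Finset.sum_eq_single s] at h1
  · rw [← hg s, DirectSum.component.lof_self, hq, hF.coeff_aeval_stdMonomial, smul_eq_mul,
      mul_one] at h1
    exact Finsupp.mem_support_iff.mp hs h1
  · intro t ht hts
    by_cases hwt : stdWeight w t = stdWeight w s
    · have hlt : stdOrder s < stdOrder t :=
        lt_of_le_of_ne (hmin t ht) fun h ↦ hts (stdIndex_ext h0 hwt h.symm)
      have hgt : DirectSum.component ℂ ℕ (Mk N) (stdWeight w t) (evalForms f (stdMonomial t)) =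
          g t := by
        rw [← hg t, DirectSum.component.lof_self]
      rw [← hwt, hgt, hq, hF.coeff_aeval_stdMonomial_of_lt t hlt, smul_zero]
    · rw [← hg t, DirectSum.component.of, dif_neg hwt]
      simp
  · exact fun h ↦ (h hs).elim

/-- The span of the standard monomials. -/
def stdSpan : Submodule ℂ (MvPolynomial (Fin 3) ℂ) := Submodule.span ℂ (Set.range stdMonomial)

theorem stdMonomial_mem_stdSpan (a : ℕ) (e : Fin 2) (b : ℕ) :
    X 0 ^ a * X 1 ^ (e : ℕ) * X 2 ^ b ∈ stdSpan :=
  Submodule.subset_span ⟨(a, e, b), rfl⟩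

/-- Division by a relation `O` that is monic of degree `2` in `X_1`: the standard monomials span
the polynomial ring modulo `O`. -/
theorem exists_sub_mem_stdSpan {O : MvPolynomial (Fin 3) ℂ}
    (hO : ∀ a b : ℕ, X 0 ^ a * X 2 ^ b * (X 1 ^ 2 - O) ∈ stdSpan) (p : MvPolynomial (Fin 3) ℂ) :
    ∃ r ∈ stdSpan, p - r ∈ Ideal.span {O} := by
  have hstep (i : Fin 3) {r : MvPolynomial (Fin 3) ℂ} (hr : r ∈ stdSpan) :
      ∃ r' ∈ stdSpan, r * X i - r' ∈ Ideal.span {O} := by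
    induction hr using Submodule.span_induction with
    | mem x hx =>
      obtain ⟨⟨a, e, b⟩, rfl⟩ := hx
      fin_cases i
      · exact ⟨_, stdMonomial_mem_stdSpan (a + 1) e b, by
          simp only [stdMonomial, Fin.zero_eta]; ring_nf; exact zero_mem _⟩
      · fin_cases e
        · exact ⟨_, stdMonomial_mem_stdSpan a 1 b, by
            simp [stdMonomial]; ring_nf; exact zero_mem _⟩
        · refine ⟨_, hO a b, ?_⟩
          rw [Ideal.mem_span_singleton]
          refine ⟨X 0 ^ a * X 2 ^ b, ?_⟩
          simp [stdMonomial]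
          ring
      · exact ⟨_, stdMonomial_mem_stdSpan a e (b + 1), by
          simp only [stdMonomial, Fin.reduceFinMk]; ring_nf; exact zero_mem _⟩
    | zero => exact ⟨0, zero_mem _, by simp⟩
    | add x y _ _ hx hy =>
      obtain ⟨x', hx', hx2⟩ := hx
      obtain ⟨y', hy', hy2⟩ := hy
      refine ⟨x' + y', add_mem hx' hy', ?_⟩
      convert add_mem hx2 hy2 using 1
      ring
    | smul c x _ hx =>
      obtain ⟨x', hx', hx2⟩ := hx
      refine ⟨c • x', Submodule.smul_mem _ _ hx', ?_⟩
      rw [smul_mul_assoc, ← smul_sub, smul_eq_C_mul]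
      exact Ideal.mul_mem_left _ _ hx2
  induction p using MvPolynomial.induction_on with
  | C c =>
    refine ⟨C c, ?_, by simp⟩
    have := Submodule.smul_mem _ c (stdMonomial_mem_stdSpan 0 0 0)
    simpa [smul_eq_C_mul] using this
  | add p q hp hq =>
    obtain ⟨x', hx', hx2⟩ := hp
    obtain ⟨y', hy', hy2⟩ := hq
    refine ⟨x' + y', add_mem hx' hy', ?_⟩
    convert add_mem hx2 hy2 using 1
    ring
  | mul_X p i hp =>
    obtain ⟨r, hr, hpr⟩ := hp
    obtain ⟨r', hr', h'⟩ := hstep i hr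
    refine ⟨r', hr', ?_⟩
    convert add_mem (Ideal.mul_mem_right (X i) _ hpr) h' using 1
    ring

/-! ### The criterion for a graded presentation -/

/-- Every nonzero form has the order of a standard monomial of the same weight. For the five levels
this is the sharp form of the Sturm bound. -/
def OrdersAreStandard (N : ℕ) (w : Fin 3 → ℕ) : Prop :=
  ∀ (k : ℕ) (g : Mk N k), g ≠ 0 →
    ∃ s : StdIndex, stdWeight w s = k ∧ (qExp N k g).order = stdOrder s

/-- Surjectivity in each weight: a form is reduced to zero by repeatedly subtracting the multiple
of a standard monomial that cancels the leading term of its `q`-expansion. -/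
theorem lof_mem_map_evalForms (h1 : 1 ≤ w 1) (h2 : 2 ≤ w 2)
    (hf : ∀ i, qExpansion 1 (f i) = F i) (hF : HasLeadingTerms F) (hN : OrdersAreStandard N w)
    (k : ℕ) (g : Mk N k) :
    DirectSum.lof ℂ ℕ (Mk N) k g ∈
      (weightedHomogeneousSubmodule ℂ w k).map (evalForms f).toLinearMap := by
  suffices ∀ (d : ℕ) (g : Mk N k), ((k + 1 : ℕ) : ℕ∞) ≤ (qExp N k g).order + d →
      DirectSum.lof ℂ ℕ (Mk N) k g ∈
        (weightedHomogeneousSubmodule ℂ w k).map (evalForms f).toLinearMap from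
    this (k + 1) g le_add_self
  intro d
  induction d with
  | zero =>
    intro g hg
    have : g = 0 := by
      by_contra hne
      obtain ⟨⟨a, e, b⟩, hw, ho⟩ := hN k g hne
      rw [ho, Nat.cast_zero, add_zero, Nat.cast_le] at hg
      simp only [stdWeight, stdOrder] at hw hg
      nlinarith
    rw [this, map_zero]
    exact zero_mem _
  | succ d ih =>
    intro g hg
    by_cases hne : g = 0
    · rw [hne, map_zero]
      exact zero_mem _
    obtain ⟨s, rfl, ho⟩ := hN k g hne
    obtain ⟨m, hm⟩ := evalForms_mem_range_lof f (stdMonomial_isWeightedHomogeneous (w := w) s)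
    have hqm : qExp N _ m = aeval F (stdMonomial s) := by
      rw [← qExpHom_evalForms f hf, ← hm]
      exact (qExpHom_of _).symm
    set c := PowerSeries.coeff (stdOrder s) (qExp N _ g) with hc
    have hsub := ih (g - c • m) ?_
    · have : DirectSum.lof ℂ ℕ (Mk N) (stdWeight w s) g =
          DirectSum.lof ℂ ℕ (Mk N) (stdWeight w s) (g - c • m) +
            c • (evalForms f).toLinearMap (stdMonomial s) := by
        rw [map_sub, map_smul, hm, AlgHom.toLinearMap_apply, sub_add_cancel]
      rw [this]
      exact add_mem hsub (Submodule.smul_mem _ _ (Submodule.mem_map_of_mem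
        (stdMonomial_isWeightedHomogeneous s)))
    · have hlt : ((stdOrder s + 1 : ℕ) : ℕ∞) ≤ (qExp N _ (g - c • m)).order := by
        refine PowerSeries.nat_le_order _ _ fun i hi ↦ ?_
        rw [map_sub, map_smul, hqm, map_sub, PowerSeries.coeff_smul]
        rcases Nat.lt_succ_iff_lt_or_eq.mp hi with hi | rfl
        · rw [hF.coeff_aeval_stdMonomial_of_lt s hi, PowerSeries.coeff_of_lt_order]
          · simp
          · rw [ho]; exact_mod_cast hi
        · rw [hF.coeff_aeval_stdMonomial, ← hc]; simp
      calc ((stdWeight w s + 1 : ℕ) : ℕ∞) ≤ (qExp N _ g).order + (d + 1 : ℕ) := hg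
        _ = ((stdOrder s + 1 : ℕ) : ℕ∞) + d := by rw [ho]; push_cast; ring
        _ ≤ _ := by gcongr

/-- The graded presentation follows once the generators start with `1`, `q`, `q ^ 2`, the relation
is monic of degree `2` in `X_1` and holds up to the order beyond which a form vanishes, and the
orders of nonzero forms are those of the standard monomials. -/
theorem hasGradedPresentation_of_ordersAreStandard {O : MvPolynomial (Fin 3) ℂ} {kO : ℕ}
    (h0 : 0 < w 0) (h1 : 1 ≤ w 1) (h2 : 2 ≤ w 2)
    (hf : ∀ i, ∃ g : Mk N (w i), qExpansion 1 g = F i)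
    (hF : HasLeadingTerms F) (hN : OrdersAreStandard N w)
    (hO : ∀ a b : ℕ, X 0 ^ a * X 2 ^ b * (X 1 ^ 2 - O) ∈ stdSpan)
    (hOw : IsWeightedHomogeneous w O kO)
    (hOF : ∀ s : StdIndex, stdWeight w s = kO →
      PowerSeries.coeff (stdOrder s) (aeval F O) = 0) :
    HasGradedPresentation N w F O := by
  choose f hf using hf
  have hOzero : evalForms f O = 0 := by
    obtain ⟨g, hg⟩ := evalForms_mem_range_lof f hOw
    have hq : qExp N kO g = aeval F O := by
      rw [← qExpHom_evalForms f hf, ← hg]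
      exact (qExpHom_of _).symm
    by_contra hne
    obtain ⟨s, hs, ho⟩ := hN kO g (by rintro rfl; exact hne (by rw [← hg, map_zero]))
    refine ((PowerSeries.order_eq_nat).mp ho).1 ?_
    rw [hq, hOF s hs]
  have hmap (k : ℕ) : (weightedHomogeneousSubmodule ℂ w k).map (evalForms f).toLinearMap =
      LinearMap.range (DirectSum.lof ℂ ℕ (Mk N) k) := by
    apply le_antisymm
    · rintro _ ⟨p, hp, rfl⟩
      exact evalForms_mem_range_lof f hp
    · rintro _ ⟨g, rfl⟩
      exact lof_mem_map_evalForms f h1 h2 hf hF hN k g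
  have hsurj : Function.Surjective (evalForms f) := by
    intro x
    change x ∈ (evalForms f).range
    induction x using DirectSum.induction_on with
    | zero => exact zero_mem _
    | of k g =>
      obtain ⟨p, -, hp⟩ := (hmap k).ge ⟨g, rfl⟩
      exact ⟨p, hp⟩
    | add x y hx hy => exact add_mem hx hy
  have hker : Ideal.span {O} = RingHom.ker (evalForms f) := by
    have hle : Ideal.span {O} ≤ RingHom.ker (evalForms f) := by
      rw [Ideal.span_singleton_le_iff_mem]
      exact hOzero
    refine le_antisymm hle fun p hp ↦ ?_
    obtain ⟨r, hr, hpr⟩ := exists_sub_mem_stdSpan hO p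
    have hr0 : evalForms f r = 0 := by
      have := hle hpr
      rw [RingHom.mem_ker, map_sub] at this
      rwa [RingHom.mem_ker.mp hp, zero_sub, neg_eq_zero] at this
    obtain ⟨l, rfl⟩ := (Finsupp.mem_span_range_iff_exists_finsupp).mp hr
    have hl := linearIndependent_iff.mp
      (linearIndependent_evalForms_stdMonomial f h0 hf hF) l (by
        rw [Finsupp.linearCombination_apply, ← hr0, Finsupp.sum, Finsupp.sum, map_sum]
        simp)
    simpa [hl] using hpr
  let e : (MvPolynomial (Fin 3) ℂ ⧸ Ideal.span {O}) ≃ₐ[ℂ] M N :=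
    (Ideal.quotientEquivAlgOfEq ℂ hker).trans (Ideal.quotientKerAlgEquivOfSurjective hsurj)
  have he (p : MvPolynomial (Fin 3) ℂ) : e (Ideal.Quotient.mk _ p) = evalForms f p := rfl
  refine ⟨f, hf, e, fun i ↦ ?_, fun k ↦ ?_⟩
  · rw [he, evalForms, aeval_X]
  · rw [← hmap k, ← Submodule.map_comp]
    rfl

end Presentation

/-! ### The Sturm bound for `Γ₀(N)` -/

section Sturm

open UpperHalfPlane CongruenceSubgroup SlashInvariantForm
open scoped MatrixGroups ModularForm Manifold

theorem mdifferentiable_quotientFunc {𝒢 ℋ : Subgroup (GL (Fin 2) ℝ)} {k : ℤ}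
    (f : ModularForm 𝒢 k) (q : ℋ ⧸ 𝒢.subgroupOf ℋ) : MDiff (quotientFunc f q) := by
  induction q using Quotient.inductionOn with
  | h r => exact (ModularForm.translate f r.val⁻¹).holo'

theorem isBoundedAtImInfty_quotientFunc {𝒢 ℋ : Subgroup (GL (Fin 2) ℝ)} [𝒢.IsFiniteRelIndex ℋ]
    {k : ℤ} (f : ModularForm 𝒢 k) (hℋ : IsCusp OnePoint.infty ℋ) (q : ℋ ⧸ 𝒢.subgroupOf ℋ) :
    IsBoundedAtImInfty (quotientFunc f q) := by
  induction q using Quotient.inductionOn with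
  | h r =>
    refine OnePoint.isBoundedAt_infty_iff.mp
      ((ModularForm.translate f r.val⁻¹).bdd_at_cusps' ?_)
    simpa using hℋ.of_isFiniteRelIndex_conj r.2

theorem slash_T_apply (f : ℍ → ℂ) (k : ℤ) (z : ℍ) :
    (f ∣[k] ModularGroup.T) z = f ((1 : ℝ) +ᵥ z) := by
  rw [ModularForm.SL_slash_apply, modular_T_smul, ModularGroup.denom_apply]
  simp [ModularGroup.T]

theorem periodic_comp_ofComplex_of_vadd {f : ℍ → ℂ} (hf : ∀ z, f ((1 : ℝ) +ᵥ z) = f z) :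
    Function.Periodic (f ∘ ofComplex) (1 : ℝ) := by
  intro w
  by_cases! hw : 0 < w.im
  · have : 0 < (w + (1 : ℝ)).im := by simp [hw]
    simp only [Function.comp_apply, ofComplex_apply_of_im_pos this, ofComplex_apply_of_im_pos hw]
    rw [← hf ⟨w, hw⟩]
    congr 1
    ext
    simp [add_comm]
  · have : (w + (1 : ℝ)).im ≤ 0 := by simpa using hw
    simp only [Function.comp_apply, ofComplex_apply_of_im_nonpos this,
      ofComplex_apply_of_im_nonpos hw]

/-- The `q`-expansion of a form divides that of its norm to level one: the other factors of the
norm are permuted by `z ↦ z + 1`, so that their product has a `q`-expansion as well. -/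
theorem qExp_dvd_qExpansion_norm {N k : ℕ} [NeZero N] (f : Mk N k) :
    qExp N k f ∣ qExpansion 1 (ModularForm.norm 𝒮ℒ f) := by
  classical
  let Q := 𝒮ℒ ⧸ ((Gamma0 N).map (Matrix.SpecialLinearGroup.mapGL ℝ)).subgroupOf 𝒮ℒ
  let : Fintype Q := Fintype.ofFinite _
  let q₀ : Q := ⟦1⟧
  let h : ℍ → ℂ := ∏ q ∈ Finset.univ.erase q₀, quotientFunc f q
  have hcusp : IsCusp OnePoint.infty 𝒮ℒ := Subgroup.isCusp_of_mem_strictPeriods one_pos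
    one_mem_strictPeriods_SL
  have hnorm : (ModularForm.norm 𝒮ℒ f : ℍ → ℂ) = f * h := by
    rw [ModularForm.coe_norm, ← Finset.mul_prod_erase _ _ (Finset.mem_univ q₀)]
    congr 1
    simp [q₀]
  have hmd : MDiff h := .prod fun q _ ↦ mdifferentiable_quotientFunc f q
  have hbd : IsBoundedAtImInfty h := by
    rw [IsBoundedAtImInfty, Filter.BoundedAtFilter,
      show (1 : ℍ → ℝ) = (fun x ↦ ∏ q ∈ Finset.univ.erase q₀, 1) by ext; simp,
      show h = fun x ↦ ∏ q ∈ Finset.univ.erase q₀, quotientFunc f q x by ext; simp [h]]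
    exact .finsetProd fun q _ ↦ isBoundedAtImInfty_quotientFunc f hcusp q
  have hT : (Matrix.SpecialLinearGroup.mapGL ℝ ModularGroup.T) ∈ 𝒮ℒ := ⟨_, rfl⟩
  -- the translation fixes the trivial coset, whose factor is `f` itself, and permutes the others
  have hfix : (⟨_, hT⟩ : 𝒮ℒ)⁻¹ • q₀ = q₀ := by
    refine Quotient.sound ?_
    rw [← Quotient.eq_iff_equiv, Quotient.eq, QuotientGroup.leftRel_apply, Subgroup.mem_subgroupOf]
    refine ⟨ModularGroup.T, ?_, ?_⟩
    · exact Gamma0_mem.mpr (by simp [ModularGroup.T])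
    · simp
  have hper : Function.Periodic (h ∘ ofComplex) (1 : ℝ) := by
    refine periodic_comp_ofComplex_of_vadd fun z ↦ ?_
    simp only [h, Finset.prod_apply]
    have hq (q : Q) : quotientFunc f q ((1 : ℝ) +ᵥ z) =
        quotientFunc f ((⟨_, hT⟩ : 𝒮ℒ)⁻¹ • q) z := by
      rw [← quotientFunc_smul f hT, ← slash_T_apply (quotientFunc f q) k]
      rfl
    simp_rw [hq]
    refine Finset.prod_bijective _ (MulAction.bijective (⟨_, hT⟩ : 𝒮ℒ)⁻¹) (fun q ↦ ?_)
      fun _ _ ↦ rfl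
    simp only [Finset.mem_erase, Finset.mem_univ, and_true, ne_eq, not_iff_not]
    exact ⟨fun hq ↦ by rw [hq, hfix], fun hq ↦ MulAction.injective _ (hq.trans hfix.symm)⟩
  refine ⟨qExpansion 1 h, ?_⟩
  rw [hnorm]
  exact qExpansion_mul
    (ModularFormClass.analyticAt_cuspFunction_zero f one_pos (one_mem_strictPeriods_Gamma0 N))
    (analyticAt_cuspFunction_zero one_pos hper hmd hbd)

theorem card_quotient_Gamma0 (N : ℕ) :
    Nat.card (𝒮ℒ ⧸ ((Gamma0 N).map (Matrix.SpecialLinearGroup.mapGL ℝ)).subgroupOf 𝒮ℒ) =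
      (Gamma0 N).index := by
  change ((Gamma0 N).map (Matrix.SpecialLinearGroup.mapGL ℝ)).relIndex 𝒮ℒ = _
  rw [MonoidHom.range_eq_map, Subgroup.relIndex_map_map_of_injective _ _
    Matrix.SpecialLinearGroup.mapGL_injective, Subgroup.relIndex_top_right]

theorem order_qExp_le_order_norm {N k : ℕ} [NeZero N] (f : Mk N k) :
    (qExp N k f).order ≤ (qExpansion 1 (ModularForm.norm 𝒮ℒ f)).order := by
  obtain ⟨H, hH⟩ := qExp_dvd_qExpansion_norm f
  rw [hH, PowerSeries.order_mul]
  exact le_self_add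

/-- **Sturm bound** for `Γ₀(N)`. -/
theorem exists_order_qExp_eq {N k : ℕ} [NeZero N] {f : Mk N k} (hf : f ≠ 0) :
    ∃ n : ℕ, (qExp N k f).order = n ∧ 12 * n ≤ k * (Gamma0 N).index := by
  obtain ⟨n, hn⟩ := ENat.ne_top_iff_exists.mp
    (PowerSeries.order_eq_top.not.mpr (qExp_eq_zero_iff.not.mpr hf))
  refine ⟨n, hn.symm, ?_⟩
  have hnorm : ModularForm.norm 𝒮ℒ f ≠ 0 :=
    ModularForm.norm_ne_zero 𝒮ℒ (by simpa using hf)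
  have hle := (order_qExp_le_order_norm f).trans
    (not_lt.mp (mt ModularForm.sturm_bound_levelOne hnorm))
  rw [← hn, Nat.cast_le, card_quotient_Gamma0] at hle
  have : ((k : ℤ) * ((Gamma0 N).index : ℤ)).toNat = k * (Gamma0 N).index := by
    rw [← Nat.cast_mul, Int.toNat_natCast]
  rw [this] at hle
  omega

/-- A level one form whose order at infinity is the largest that its weight allows is a multiple of
a power of the discriminant, hence vanishes nowhere. -/
theorem levelOne_apply_ne_zero {n : ℕ} {k : ℤ} (hk : k ≤ 12 * n) {g : ModularForm 𝒮ℒ k}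
    (hg : g ≠ 0) (ho : (n : ℕ∞) ≤ (qExpansion 1 g).order) (z : ℍ) : g z ≠ 0 := by
  induction n generalizing k with
  | zero =>
    rcases hk.lt_or_eq with hlt | rfl
    · exact absurd (DFunLike.coe_injective
        (ModularFormClass.levelOne_neg_weight_eq_zero (by simpa using hlt) g)) hg
    · obtain ⟨c, hc⟩ := ModularForm.eq_const_of_weight_zero (ModularForm.mcast (by simp) g)
      have hc' : (g : ℍ → ℂ) = Function.const ℍ c := hc
      rw [hc']
      rintro rfl
      exact hg (DFunLike.coe_injective hc')
  | succ n ih =>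
    have h0 : (qExpansion 1 g).coeff 0 = 0 :=
      PowerSeries.coeff_of_lt_order _ (lt_of_lt_of_le (by exact_mod_cast n.succ_pos) ho)
    set g' := CuspForm.discriminantEquiv (ModularForm.toCuspForm g h0) with hg'
    have hmul (z : ℍ) : g z = ModularForm.discriminant z * g' z :=
      (ModularForm.discriminant_mul_discriminantEquiv_apply (ModularForm.toCuspForm g h0) z).symm
    rw [ModularForm.qExpansion_eq_qExpansion_discriminant_mul g h0, PowerSeries.order_mul,
      ModularForm.discriminant_qExpansion_order, Nat.cast_succ, add_comm] at ho
    have hne : g' ≠ 0 := by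
      intro h
      refine hg (ModularForm.ext fun z ↦ ?_)
      rw [hmul, h]
      simp
    rw [hmul]
    exact mul_ne_zero (ModularForm.discriminant_ne_zero z)
      (ih (by push_cast at hk; omega) hne
        ((ENat.add_le_add_iff_left ENat.one_ne_top).mp ho))

/-- A nonzero form that vanishes somewhere in the upper half plane does not attain the Sturm
bound. -/
theorem order_qExp_lt_of_apply_eq_zero {N k : ℕ} [NeZero N] {f : Mk N k} (hf : f ≠ 0) {z : ℍ}
    (hz : f z = 0) {n : ℕ} (hn : k * (Gamma0 N).index ≤ 12 * n) :
    (qExp N k f).order < n := by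
  by_contra! hle
  refine levelOne_apply_ne_zero (n := n) ?_ (ModularForm.norm_ne_zero 𝒮ℒ (by simpa using hf))
    (hle.trans (order_qExp_le_order_norm f)) z ?_
  · rw [card_quotient_Gamma0]
    exact_mod_cast hn
  · let : Fintype (𝒮ℒ ⧸ ((Gamma0 N).map (Matrix.SpecialLinearGroup.mapGL ℝ)).subgroupOf 𝒮ℒ) :=
      Fintype.ofFinite _
    rw [ModularForm.coe_norm, Finset.prod_apply]
    exact Finset.prod_eq_zero (Finset.mem_univ (QuotientGroup.mk 1))
      (show quotientFunc f ⟦1⟧ z = 0 by simpa using hz)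

theorem eq_zero_of_odd {N k : ℕ} (hk : Odd k) (f : Mk N k) : f = 0 := by
  have : (-1 : GL (Fin 2) ℝ) ∈ (Gamma0 N).map (Matrix.SpecialLinearGroup.mapGL ℝ) :=
    ⟨-1, by simp [Gamma0_mem], by ext; simp⟩
  exact ModularForm.eq_zero_of_neg_one_mem this (by exact_mod_cast hk) f

end Sturm

/-! ### The index of `Γ₀(N)` -/

section Index

open CongruenceSubgroup
open scoped MatrixGroups

/-- The index of `Γ₀(N)` is at most the number of points of a list of integer vectors that covers
the projective line over `ℤ / N`. -/
theorem index_Gamma0_le {N m : ℕ} (a c : Fin m → ℤ) (hac : ∀ i, IsCoprime (a i) (c i))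
    (h : ∀ x y : ZMod N, (∀ t : ZMod N, t * x = 0 → t * y = 0 → t = 0) →
      ∃ i, (a i : ZMod N) * y = c i * x) : (Gamma0 N).index ≤ m := by
  choose u v huv using hac
  let r (i : Fin m) : SL(2, ℤ) :=
    ⟨!![a i, -v i; c i, u i], by rw [Matrix.det_fin_two_of]; linear_combination huv i⟩
  have hr : Function.Surjective fun i ↦ (QuotientGroup.mk (r i) : SL(2, ℤ) ⧸ Gamma0 N) := by
    intro q
    obtain ⟨g, rfl⟩ := QuotientGroup.mk_surjective q
    have hdet : (g 0 0 : ZMod N) * g 1 1 - g 0 1 * g 1 0 = 1 := by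
      have := congrArg (Int.cast : ℤ → ZMod N) (g.det_coe)
      rw [Matrix.det_fin_two] at this
      exact_mod_cast this
    obtain ⟨i, hi⟩ := h (g 0 0) (g 1 0) fun t h0 h1 ↦ by
      linear_combination (-t) * hdet + h0 * g 1 1 - h1 * g 0 1
    refine ⟨i, QuotientGroup.eq.mpr ?_⟩
    have hentry : ((r i)⁻¹ * g) 1 0 = -c i * g 0 0 + a i * g 1 0 := by
      rw [Matrix.SpecialLinearGroup.SL2_inv_expl]
      exact (Matrix.two_mul_expl _ _).2.2.1
    rw [Gamma0_mem, hentry]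
    push_cast
    linear_combination hi
  simpa [Subgroup.index] using Nat.card_le_card_of_surjective _ hr

theorem index_Gamma0_three_le : (Gamma0 3).index ≤ 4 := by
  refine index_Gamma0_le ![1, 1, 1, 0] ![0, 1, 2, 1] (fun i ↦ ?_) (by decide +kernel)
  rw [Int.isCoprime_iff_gcd_eq_one]
  decide +revert

theorem index_Gamma0_five_le : (Gamma0 5).index ≤ 6 := by
  refine index_Gamma0_le ![1, 1, 1, 1, 1, 0] ![0, 1, 2, 3, 4, 1] (fun i ↦ ?_) (by decide +kernel)
  rw [Int.isCoprime_iff_gcd_eq_one]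
  decide +revert

theorem index_Gamma0_six_le : (Gamma0 6).index ≤ 12 := by
  refine index_Gamma0_le ![1, 1, 1, 1, 1, 1, 0, 2, 3, 4, 2, 3] ![0, 1, 2, 3, 4, 5, 1, 1, 1, 1, 3, 2]
    (fun i ↦ ?_) (by decide +kernel)
  rw [Int.isCoprime_iff_gcd_eq_one]
  decide +revert

theorem index_Gamma0_eight_le : (Gamma0 8).index ≤ 12 := by
  refine index_Gamma0_le ![1, 1, 1, 1, 1, 1, 1, 1, 0, 2, 4, 6] ![0, 1, 2, 3, 4, 5, 6, 7, 1, 1, 1, 1]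
    (fun i ↦ ?_) (by decide +kernel)
  rw [Int.isCoprime_iff_gcd_eq_one]
  decide +revert

theorem index_Gamma0_nine_le : (Gamma0 9).index ≤ 12 := by
  refine index_Gamma0_le ![1, 1, 1, 1, 1, 1, 1, 1, 1, 0, 3, 6] ![0, 1, 2, 3, 4, 5, 6, 7, 8, 1, 1, 1]
    (fun i ↦ ?_) (by decide +kernel)
  rw [Int.isCoprime_iff_gcd_eq_one]
  decide +revert

end Index

/-! ### Orders of nonzero forms at the five levels -/

section Orders

open UpperHalfPlane CongruenceSubgroup
open scoped MatrixGroups ModularForm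

-- In the following proofs the order `n` given by the Sturm bound determines `ε = n % 2` and
-- `b = n / 2`. The bound and the parity of the weight ensure that the exponent `a` that completes
-- the weight is not truncated.

theorem ordersAreStandard_three : OrdersAreStandard 3 ![2, 4, 6] := by
  intro k g hg
  obtain ⟨n, hn, hle⟩ := exists_order_qExp_eq hg
  have hk : Even k := Nat.not_odd_iff_even.mp fun h ↦ hg (eq_zero_of_odd h g)
  have := hle.trans (Nat.mul_le_mul_left k index_Gamma0_three_le)
  obtain ⟨m, rfl⟩ := hk
  refine ⟨(m - 2 * (n % 2) - 3 * (n / 2), ⟨n % 2, by omega⟩, n / 2), ?_, ?_⟩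
  · simp [stdWeight]
    omega
  · rw [hn, stdOrder]
    congr 1
    simp only
    omega

/-- At a level of index at most `12`, with all generators of weight `2`. -/
theorem ordersAreStandard_of_index_le {N : ℕ} [NeZero N] (hN : (Gamma0 N).index ≤ 12) :
    OrdersAreStandard N ![2, 2, 2] := by
  intro k g hg
  obtain ⟨n, hn, hle⟩ := exists_order_qExp_eq hg
  have hk : Even k := Nat.not_odd_iff_even.mp fun h ↦ hg (eq_zero_of_odd h g)
  have := hle.trans (Nat.mul_le_mul_left k hN)
  obtain ⟨m, rfl⟩ := hk
  refine ⟨(m - n % 2 - n / 2, ⟨n % 2, by omega⟩, n / 2), ?_, ?_⟩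
  · simp [stdWeight]
    omega
  · rw [hn, stdOrder]
    congr 1
    simp only
    omega

/-- The elliptic point `(2 + i) / 5` of `Γ₀(5)`. -/
def ellipticPoint : ℍ := ⟨(2 + Complex.I) / 5, by simp⟩

/-- In weight `k ≡ 2 mod 4` every form for `Γ₀(5)` vanishes at the elliptic point, which is fixed by
an element of order `4` acting there with automorphy factor `i ^ k = -1`. -/
theorem apply_ellipticPoint_eq_zero {m : ℕ} (f : Mk 5 (4 * m + 2)) : f ellipticPoint = 0 := by
  let γ : SL(2, ℤ) := ⟨!![2, -1; 5, -2], by simp [Matrix.det_fin_two_of]⟩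
  have hγ : γ ∈ Gamma0 5 := by
    rw [Gamma0_mem]
    exact (by decide : ((5 : ℤ) : ZMod 5) = 0)
  have hden : denom (γ : GL (Fin 2) ℝ) ellipticPoint = Complex.I := by
    rw [ModularGroup.denom_apply]
    simp [γ, ellipticPoint]
    ring
  have hfix : γ • ellipticPoint = ellipticPoint := by
    rw [UpperHalfPlane.ext_iff, UpperHalfPlane.coe_specialLinearGroup_apply]
    have hd : (5 : ℂ) * ((2 + Complex.I) / 5) - 2 = Complex.I := by ring
    simp [γ, ellipticPoint, ← sub_eq_add_neg]
    rw [hd, div_eq_iff Complex.I_ne_zero]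
    linear_combination (-1 / 5 : ℂ) * Complex.I_sq
  have hinv := congrFun (SlashInvariantFormClass.slash_action_eq f
    (Matrix.SpecialLinearGroup.mapGL ℝ γ) ⟨γ, hγ, rfl⟩) ellipticPoint
  change ((f : ℍ → ℂ) ∣[((4 * m + 2 : ℕ) : ℤ)] γ) _ = _ at hinv
  rw [ModularForm.SL_slash_apply, hfix, hden, zpow_neg, zpow_natCast,
    pow_add, pow_mul, Complex.I_pow_four, one_pow, one_mul, Complex.I_sq] at hinv
  linear_combination (-1 / 2 : ℂ) * hinv

theorem ordersAreStandard_five : OrdersAreStandard 5 ![2, 4, 4] := by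
  intro k g hg
  obtain ⟨n, hn, hle⟩ := exists_order_qExp_eq hg
  have hk : Even k := Nat.not_odd_iff_even.mp fun h ↦ hg (eq_zero_of_odd h g)
  have := hle.trans (Nat.mul_le_mul_left k index_Gamma0_five_le)
  have hne : k % 4 = 2 → 2 * n ≠ k := by
    intro h4
    obtain ⟨m, rfl⟩ : ∃ m, k = 4 * m + 2 := ⟨k / 4, by omega⟩
    have hlt := order_qExp_lt_of_apply_eq_zero hg (apply_ellipticPoint_eq_zero g) (n := 2 * m + 1)
      ((Nat.mul_le_mul_left _ index_Gamma0_five_le).trans (by omega))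
    rw [hn, Nat.cast_lt] at hlt
    omega
  obtain ⟨m, rfl⟩ := hk
  refine ⟨(m - 2 * (n % 2) - 2 * (n / 2), ⟨n % 2, by omega⟩, n / 2), ?_, ?_⟩
  · simp [stdWeight]
    omega
  · rw [hn, stdOrder]
    congr 1
    simp only
    omega

end Orders

/-! ### Modular forms on `Γ₀(N)` from `SL(2, ℤ)`-invariant functions -/

section Slash

open UpperHalfPlane CongruenceSubgroup Matrix.SpecialLinearGroup
open scoped MatrixGroups ModularForm Manifold Pointwise

/-- The matrix of the affine substitution `z ↦ a z + b`. -/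
def affine (a b : ℚ) (ha : 0 < a) : GL (Fin 2) ℚ :=
  Matrix.GeneralLinearGroup.mkOfDetNeZero !![a, b; 0, 1] (by simp [Matrix.det_fin_two_of, ha.ne'])

/-- The matrix of the affine substitution `z ↦ a z + b`, with real entries. -/
def affineReal (a b : ℚ) (ha : 0 < a) : GL (Fin 2) ℝ := (affine a b ha).map (Rat.castHom ℝ)

variable {a b : ℚ} {ha : 0 < a}

theorem coe_affineReal : (affineReal a b ha : Matrix (Fin 2) (Fin 2) ℝ) = !![(a : ℝ), b; 0, 1] := by
  ext i j
  fin_cases i <;> fin_cases j <;>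
    simp [affineReal, affine, Matrix.GeneralLinearGroup.mkOfDetNeZero]

theorem det_affineReal : (affineReal a b ha).det.val = a := by
  rw [Matrix.GeneralLinearGroup.val_det_apply, coe_affineReal]
  simp [Matrix.det_fin_two_of]

theorem denom_affineReal (z : ℂ) : denom (affineReal a b ha) z = 1 := by
  simp [denom, coe_affineReal]

theorem coe_affineReal_smul (z : ℍ) : ((affineReal a b ha • z : ℍ) : ℂ) = a * z + b := by
  rw [coe_smul_of_det_pos (by rw [det_affineReal]; exact_mod_cast ha), denom_affineReal]
  simp [num, coe_affineReal]

theorem im_affineReal_smul (z : ℍ) : (affineReal a b ha • z).im = a * z.im := by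
  rw [← coe_im, coe_affineReal_smul]
  simp

theorem slash_affineReal_apply (F : ℍ → ℂ) (k : ℤ) (z : ℍ) :
    (F ∣[k] affineReal a b ha) z = a ^ (k - 1) * F (affineReal a b ha • z) := by
  have hσ : σ (affineReal a b ha) = ContinuousAlgEquiv.refl ℝ ℂ := by
    rw [σ, if_pos (by rw [det_affineReal]; exact_mod_cast ha)]
  have hdet : |(affineReal a b ha).det.val| = (a : ℝ) := by
    rw [det_affineReal, abs_of_pos (by exact_mod_cast ha)]
  rw [ModularForm.slash_apply, hσ, hdet, denom_affineReal]
  simp [mul_comm]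

theorem exists_SL2 {a b c d : ℤ} (h : a * d - b * c = 1) :
    ∃ γ : SL(2, ℤ), γ 0 0 = a ∧ γ 0 1 = b ∧ γ 1 0 = c ∧ γ 1 1 = d :=
  ⟨⟨!![a, b; c, d], by rw [Matrix.det_fin_two_of, h]⟩, rfl, rfl, rfl, rfl⟩

/-- `A` conjugates `Γ₀(N)` into `SL(2, ℤ)`. -/
def ConjugatesGamma0 (N : ℕ) (A : GL (Fin 2) ℝ) : Prop :=
  ∀ γ ∈ Gamma0 N, ∃ γ' : SL(2, ℤ), A * mapGL ℝ γ = mapGL ℝ γ' * A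

theorem conjugatesGamma0_dilation {N d : ℕ} (hd : 0 < (d : ℚ)) (h : d ∣ N) :
    ConjugatesGamma0 N (affineReal d 0 hd) := by
  intro γ hγ
  rw [Gamma0_mem, ZMod.intCast_zmod_eq_zero_iff_dvd] at hγ
  obtain ⟨c, hc⟩ := (Int.natCast_dvd_natCast.mpr h).trans hγ
  have hdet := γ.det_coe
  rw [Matrix.det_fin_two] at hdet
  obtain ⟨γ', h00, h01, h10, h11⟩ := exists_SL2 (a := γ 0 0) (b := d * γ 0 1) (c := c) (d := γ 1 1)
    (by linear_combination hdet + γ 0 1 * hc)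
  refine ⟨γ', ?_⟩
  have hc' : ((γ 1 0 : ℤ) : ℝ) = d * c := by rw [hc]; push_cast; rfl
  ext i j
  rw [Units.val_mul, Units.val_mul, coe_affineReal]
  fin_cases i <;> fin_cases j <;>
    simp [Matrix.mul_apply, Fin.sum_univ_two, hc', h00, h01, h10, h11, mul_comm]

theorem conjugatesGamma0_translation (u : ℤ) :
    ConjugatesGamma0 9 (affineReal 1 (u / 3) one_pos) := by
  intro γ hγ
  rw [Gamma0_mem, ZMod.intCast_zmod_eq_zero_iff_dvd] at hγ
  obtain ⟨c, hc⟩ := hγ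
  have hdet := γ.det_coe
  rw [Matrix.det_fin_two] at hdet
  -- `a d ≡ 1` modulo `3` forces `a ≡ d`
  obtain ⟨t, ht⟩ : (3 : ℤ) ∣ γ 1 1 - γ 0 0 := by
    have h3 : ((γ 0 0 : ℤ) : ZMod 3) * (γ 1 1 : ℤ) = 1 := by
      have := congrArg (Int.cast : ℤ → ZMod 3) hdet
      rw [hc] at this
      push_cast at this
      rw [show (9 : ZMod 3) = 0 from rfl] at this
      linear_combination this
    refine (ZMod.intCast_zmod_eq_zero_iff_dvd _ 3).mp ?_
    push_cast
    generalize ((γ 0 0 : ℤ) : ZMod 3) = x at *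
    generalize ((γ 1 1 : ℤ) : ZMod 3) = y at *
    decide +revert
  push_cast at hc
  obtain ⟨γ', h00, h01, h10, h11⟩ := exists_SL2 (a := γ 0 0 + 3 * u * c)
    (b := γ 0 1 + u * t - u ^ 2 * c) (c := 9 * c) (d := γ 1 1 - 3 * u * c)
    (by linear_combination hdet + γ 0 1 * hc + 3 * u * c * ht)
  refine ⟨γ', ?_⟩
  have hc' : ((γ 1 0 : ℤ) : ℝ) = 9 * c := by rw [hc]; push_cast; rfl
  have ht' : ((γ 1 1 : ℤ) : ℝ) = γ 0 0 + 3 * t := by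
    rw [show γ 1 1 = γ 0 0 + 3 * t by linear_combination ht]; push_cast; rfl
  ext i j
  rw [Units.val_mul, Units.val_mul, coe_affineReal]
  fin_cases i <;> fin_cases j <;>
    simp [Matrix.mul_apply, Fin.sum_univ_two, hc', ht', h00, h01, h10, h11] <;> ring

theorem slash_slash_of_conjugatesGamma0 {N : ℕ} {k : ℤ} {F : ℍ → ℂ}
    (hF : ∀ γ : SL(2, ℤ), F ∣[k] γ = F) {A : GL (Fin 2) ℝ} (hA : ConjugatesGamma0 N A)
    {γ : SL(2, ℤ)} (hγ : γ ∈ Gamma0 N) : (F ∣[k] A) ∣[k] mapGL ℝ γ = F ∣[k] A := by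
  obtain ⟨γ', h⟩ := hA γ hγ
  rw [← SlashAction.slash_mul, h, SlashAction.slash_mul]
  congr 1
  exact hF γ'

/-- An `SL(2, ℤ)`-invariant function that is bounded at infinity stays bounded at every cusp after
a rational substitution, as the cusps of `SL(2, ℤ)` form a single orbit. -/
theorem isBoundedAt_slash {k : ℤ} {F : ℍ → ℂ} (hF : ∀ γ : SL(2, ℤ), F ∣[k] γ = F)
    (hb : IsBoundedAtImInfty F) {c : OnePoint ℝ} (hc : IsCusp c 𝒮ℒ) :
    c.IsBoundedAt (F ∣[k] affineReal a b ha) k := by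
  rw [← OnePoint.IsBoundedAt.smul_iff]
  have h1 : (ConjAct.toConjAct (affineReal a b ha) • 𝒮ℒ).IsArithmetic :=
    Subgroup.IsArithmetic.conj 𝒮ℒ (affine a b ha)
  have h2 : IsCusp (affineReal a b ha • c) 𝒮ℒ :=
    (Subgroup.IsArithmetic.isCusp_iff_isCusp_SL2Z _).mp (hc.smul (affineReal a b ha))
  rw [OnePoint.isBoundedAt_iff_forall_SL2Z h2]
  intro γ _
  rwa [hF γ]

theorem exists_modularForm {N k : ℕ} [NeZero N] {F : ℍ → ℂ} (hd : MDiff F)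
    (hinv : ∀ γ ∈ Gamma0 N, F ∣[(k : ℤ)] mapGL ℝ γ = F)
    (hb : ∀ {c : OnePoint ℝ}, IsCusp c 𝒮ℒ → c.IsBoundedAt F k) : ∃ f : Mk N k, ⇑f = F :=
  ⟨{ toFun := F
     slash_action_eq' := by
      rintro _ ⟨γ, hγ, rfl⟩
      exact hinv γ hγ
     holo' := hd
     bdd_at_cusps' := fun hc ↦ hb ((Subgroup.IsArithmetic.isCusp_iff_isCusp_SL2Z _).mp hc) }, rfl⟩

theorem exists_modularForm_slash {N k : ℕ} [NeZero N] (f : ModularForm 𝒮ℒ (k : ℤ))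
    (hA : ConjugatesGamma0 N (affineReal a b ha)) :
    ∃ g : Mk N k, ⇑g = (f : ℍ → ℂ) ∣[(k : ℤ)] affineReal a b ha := by
  have hinv (γ : SL(2, ℤ)) : (f : ℍ → ℂ) ∣[(k : ℤ)] γ = f :=
    SlashInvariantFormClass.slash_action_eq f (mapGL ℝ γ) ⟨γ, rfl⟩
  have : Fact (IsCusp OnePoint.infty 𝒮ℒ) :=
    ⟨Subgroup.isCusp_of_mem_strictPeriods one_pos one_mem_strictPeriods_SL⟩
  exact exists_modularForm (MDifferentiable.slash (ModularFormClass.holo f) _ _)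
    (fun γ hγ ↦ slash_slash_of_conjugatesGamma0 hinv hA hγ)
    (isBoundedAt_slash hinv (ModularFormClass.bdd_at_infty f))

/-! ### The Eisenstein series of weight two -/

/-- The non-holomorphic Eisenstein series `E₂(z) - 3 / (π Im z)` of weight `2`, which is invariant
under `SL(2, ℤ)`. -/
def E2Star (z : ℍ) : ℂ := EisensteinSeries.E2 z - 3 / (Real.pi * z.im)

theorem E2Star_slash (γ : SL(2, ℤ)) : E2Star ∣[(2 : ℤ)] γ = E2Star := by
  ext z
  have h := congrFun (EisensteinSeries.E2_slash_action γ) z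
  rw [ModularForm.SL_slash_apply] at h ⊢
  simp only [Pi.sub_apply, Pi.smul_apply, smul_eq_mul, EisensteinSeries.D2] at h
  rw [E2Star, sub_mul, h, E2Star, riemannZeta_two]
  have hden := denom_ne_zero γ z
  have hnorm : ((γ • z).im : ℂ) = z.im / (denom γ z * (starRingEnd ℂ) (denom γ z)) := by
    rw [Complex.mul_conj, ModularGroup.im_smul_eq_div_normSq]
    push_cast
    rfl
  -- the conjugate of `c z + d` is `(c z + d) - 2 i c y`, which produces the defect of `E₂`
  have hconj : (starRingEnd ℂ) (denom γ z) = denom γ z - 2 * Complex.I * γ 1 0 * z.im := by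
    rw [ModularGroup.denom_apply]
    simp only [map_add, map_mul, map_intCast]
    have : (starRingEnd ℂ) (z : ℂ) = z - 2 * Complex.I * z.im := by
      apply Complex.ext <;> simp
      ring
    rw [this]
    ring
  have hden' : (starRingEnd ℂ) (denom γ z) ≠ 0 := by simp [hden]
  have hpi : (Real.pi : ℂ) ≠ 0 := by exact_mod_cast Real.pi_ne_zero
  have him : (z.im : ℂ) ≠ 0 := by exact_mod_cast z.im_ne_zero
  rw [hnorm, show (3 : ℂ) / (Real.pi * (z.im / (denom γ z * (starRingEnd ℂ) (denom γ z)))) *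
      denom γ z ^ (-2 : ℤ) = 3 / (Real.pi * z.im) *
        ((starRingEnd ℂ) (denom γ z) / denom γ z) by
      rw [zpow_neg]; field_simp, hconj]
  field_simp
  ring

theorem isBoundedAtImInfty_E2Star : IsBoundedAtImInfty E2Star := by
  refine EisensteinSeries.isBoundedAtImInfty_E2.sub ?_
  refine Asymptotics.isBigO_iff.mpr ?_
  refine ⟨3 / Real.pi, ?_⟩
  have : ∀ᶠ z in atImInfty, 1 ≤ UpperHalfPlane.im z :=
    (UpperHalfPlane.atImInfty_mem _).mpr ⟨1, fun z hz ↦ hz⟩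
  filter_upwards [this] with z hz
  rw [norm_div, norm_mul, Complex.norm_real, Complex.norm_real, Real.norm_of_nonneg Real.pi_pos.le,
    Real.norm_of_nonneg z.im_pos.le]
  simp only [RCLike.norm_ofNat, Pi.one_apply, norm_one, mul_one]
  gcongr
  exact le_mul_of_one_le_right Real.pi_pos.le hz

theorem E2Star_slash_affineReal_apply (z : ℍ) :
    (E2Star ∣[(2 : ℤ)] affineReal a b ha) z =
      (EisensteinSeries.E2 ∣[(2 : ℤ)] affineReal a b ha) z - 3 / (Real.pi * z.im) := by
  rw [slash_affineReal_apply, slash_affineReal_apply, E2Star, im_affineReal_smul, mul_sub]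
  have ha' : (a : ℂ) ≠ 0 := by exact_mod_cast ha.ne'
  have hpi : (Real.pi : ℂ) ≠ 0 := by exact_mod_cast Real.pi_ne_zero
  have him : (z.im : ℂ) ≠ 0 := by exact_mod_cast z.im_ne_zero
  congr 1
  push_cast
  norm_num
  field_simp

/-- Affine substitutions do not change the non-holomorphic part of `E2Star`, so that differences of
the transforms of `E₂` are holomorphic modular forms. -/
theorem exists_modularForm_E2_sub {N : ℕ} [NeZero N] {a' b' : ℚ} {ha' : 0 < a'}
    (hA : ConjugatesGamma0 N (affineReal a b ha)) (hB : ConjugatesGamma0 N (affineReal a' b' ha')) :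
    ∃ f : Mk N 2, ⇑f = EisensteinSeries.E2 ∣[(2 : ℤ)] affineReal a b ha -
      EisensteinSeries.E2 ∣[(2 : ℤ)] affineReal a' b' ha' := by
  have h : EisensteinSeries.E2 ∣[(2 : ℤ)] affineReal a b ha -
      EisensteinSeries.E2 ∣[(2 : ℤ)] affineReal a' b' ha' =
      E2Star ∣[(2 : ℤ)] affineReal a b ha + -(E2Star ∣[(2 : ℤ)] affineReal a' b' ha') := by
    ext z
    simp only [Pi.sub_apply, Pi.add_apply, Pi.neg_apply, E2Star_slash_affineReal_apply]
    ring
  refine exists_modularForm (k := 2) ?_ (fun γ hγ ↦ ?_) fun {c} hc ↦ ?_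
  · exact (MDifferentiable.slash E2_mdifferentiable _ _).sub
      (MDifferentiable.slash E2_mdifferentiable _ _)
  · rw [h, SlashAction.add_slash, SlashAction.neg_slash]
    congr 1
    · exact slash_slash_of_conjugatesGamma0 E2Star_slash hA hγ
    · congr 1
      exact slash_slash_of_conjugatesGamma0 E2Star_slash hB hγ
  · rw [h]
    refine (isBoundedAt_slash E2Star_slash isBoundedAtImInfty_E2Star hc).add ?_
    intro g hg
    rw [SlashAction.neg_slash]
    exact (isBoundedAt_slash E2Star_slash isBoundedAtImInfty_E2Star hc g hg).neg

end Slash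

/-! ### `q`-expansions of the generators -/

section QExpansions

open UpperHalfPlane Function.Periodic
open scoped MatrixGroups ModularForm

/-- The function `f` is given on the whole upper half plane by the series `F` in
`q = exp(2πiz)`. -/
def HasQSeries (f : ℍ → ℂ) (F : ℂ⟦X⟧) : Prop :=
  ∀ z : ℍ, HasSum (fun n ↦ PowerSeries.coeff n F • qParam 1 z ^ n) (f z)

theorem HasQSeries.sub {f g : ℍ → ℂ} {F G : ℂ⟦X⟧} (hf : HasQSeries f F) (hg : HasQSeries g G) :
    HasQSeries (f - g) (F - G) := fun z ↦ by
  simpa [sub_mul] using (hf z).sub (hg z)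

theorem HasQSeries.smul {f : ℍ → ℂ} {F : ℂ⟦X⟧} (hf : HasQSeries f F) (c : ℂ) :
    HasQSeries (c • f) (c • F) := fun z ↦ by
  simpa [mul_assoc] using (hf z).mul_left c

theorem coeff_V (h : ℕ) (f : ℂ⟦X⟧) (n : ℕ) :
    PowerSeries.coeff n (V h f) = if h ∣ n then PowerSeries.coeff (n / h) f else 0 :=
  PowerSeries.coeff_mk _ _

theorem HasQSeries.slash_dilation {f : ℍ → ℂ} {F : ℂ⟦X⟧} (hf : HasQSeries f F) (k : ℤ) {d : ℕ}
    (hd : 0 < (d : ℚ)) :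
    HasQSeries (f ∣[k] affineReal d 0 hd) ((d : ℂ) ^ (k - 1) • V d F) := by
  have hd0 : d ≠ 0 := by rintro rfl; simp at hd
  have key : HasQSeries (fun z ↦ f (affineReal d 0 hd • z)) (V d F) := by
    intro z
    have hq : qParam 1 (affineReal d 0 hd • z : ℍ) = qParam 1 z ^ d := by
      rw [coe_affineReal_smul, qParam, qParam, ← Complex.exp_nat_mul]
      congr 1
      push_cast
      ring
    rw [← (mul_right_injective₀ hd0).hasSum_iff]
    · convert! hf (affineReal d 0 hd • z) using 2 with n
      simp only [Function.comp_apply, coeff_V, dvd_mul_right, if_true,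
        Nat.mul_div_cancel_left _ (Nat.pos_of_ne_zero hd0), hq, pow_mul]
    · intro n hn
      rw [coeff_V, if_neg, zero_smul]
      rintro ⟨m, rfl⟩
      exact hn ⟨m, rfl⟩
  convert! key.smul ((d : ℂ) ^ (k - 1)) using 1
  ext z
  rw [slash_affineReal_apply]
  simp

theorem HasQSeries.slash_translation {f : ℍ → ℂ} {F : ℂ⟦X⟧} (hf : HasQSeries f F) (k : ℤ) (b : ℚ) :
    HasQSeries (f ∣[k] affineReal 1 b one_pos) (PowerSeries.mk fun n ↦
      Complex.exp (2 * Real.pi * Complex.I * b) ^ n * PowerSeries.coeff n F) := by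
  intro z
  have hq : qParam 1 (affineReal 1 b one_pos • z : ℍ) =
      Complex.exp (2 * Real.pi * Complex.I * b) * qParam 1 z := by
    rw [coe_affineReal_smul, qParam, qParam, ← Complex.exp_add]
    congr 1
    push_cast
    ring
  have h := hf (affineReal 1 b one_pos • z)
  rw [slash_affineReal_apply, Rat.cast_one, one_zpow, one_mul]
  convert! h using 2 with n
  rw [hq, PowerSeries.coeff_mk, mul_pow, smul_eq_mul, smul_eq_mul]
  ring

theorem mem_range_qExp {N k : ℕ} {f : Mk N k} {F : ℂ⟦X⟧} (h : HasQSeries f F) :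
    F ∈ LinearMap.range (qExp N k) :=
  ⟨f, PowerSeries.ext fun n ↦ (ModularFormClass.qExpansion_coeff_unique one_pos
    (one_mem_strictPeriods_Gamma0 N) h n).symm⟩

theorem mul_mem_range_qExp {N a b c : ℕ} {F G : ℂ⟦X⟧} (hF : F ∈ LinearMap.range (qExp N a))
    (hG : G ∈ LinearMap.range (qExp N b)) (hc : a + b = c) :
    F * G ∈ LinearMap.range (qExp N c) := by
  subst hc
  obtain ⟨f, rfl⟩ := hF
  obtain ⟨g, rfl⟩ := hG
  exact ⟨ModularForm.mcast (by push_cast; rfl) (f.mul g),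
    ModularForm.qExpansion_mul one_pos (one_mem_strictPeriods_Gamma0 N) f g⟩

theorem bernoulli_two_eq : bernoulli 2 = 1 / 6 := by decide +kernel
theorem bernoulli_four_eq : bernoulli 4 = -1 / 30 := by decide +kernel
theorem bernoulli_six_eq : bernoulli 6 = 1 / 42 := by decide +kernel

theorem hasQSeries_E2 : HasQSeries EisensteinSeries.E2 (E 2) := by
  intro z
  convert! EisensteinSeries.hasSum_qExpansion_E2 (z := z) using 2 with n
  · simp only [E, PowerSeries.coeff_mk, bernoulli_two_eq, qParam, Complex.ofReal_one, div_one]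
    norm_num

theorem hasQSeries_E {k : ℕ} (hk : 3 ≤ k) (hk2 : Even k) :
    HasQSeries (ModularForm.E hk) (E k) := by
  have : Fact (IsCusp OnePoint.infty 𝒮ℒ) :=
    ⟨Subgroup.isCusp_of_mem_strictPeriods one_pos one_mem_strictPeriods_SL⟩
  intro z
  have h := ModularForm.hasSum_qExpansion (f := ModularForm.E hk) one_pos
    one_mem_strictPeriods_SL z
  simp_rw [EisensteinSeries.E_qExpansion_coeff hk hk2] at h
  simpa only [E, PowerSeries.coeff_mk, smul_eq_mul] using h

theorem V_E_mem_range {N d k : ℕ} [NeZero N] (hk : 3 ≤ k) (hk2 : Even k) (hd : d ∣ N) :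
    V d (E k) ∈ LinearMap.range (qExp N k) := by
  have hd0 : d ≠ 0 := by rintro rfl; exact NeZero.ne N (zero_dvd_iff.mp hd)
  have hdQ : 0 < (d : ℚ) := by exact_mod_cast Nat.pos_of_ne_zero hd0
  obtain ⟨g, hg⟩ := exists_modularForm_slash (ModularForm.E hk) (conjugatesGamma0_dilation hdQ hd)
  have h := mem_range_qExp (f := g) (hg ▸ (hasQSeries_E hk hk2).slash_dilation k hdQ)
  refine (Submodule.smul_mem_iff _ (zpow_ne_zero _ ?_)).mp h
  exact_mod_cast hd0

theorem V_one (f : ℂ⟦X⟧) : V 1 f = f := by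
  ext n
  simp [coeff_V]

theorem V_V {a b : ℕ} (ha : a ≠ 0) (f : ℂ⟦X⟧) : V a (V b f) = V (a * b) f := by
  ext n
  simp only [coeff_V]
  by_cases h : a ∣ n
  · obtain ⟨m, rfl⟩ := h
    rw [if_pos (dvd_mul_right _ _), Nat.mul_div_cancel_left _ (Nat.pos_of_ne_zero ha),
      Nat.mul_div_mul_left _ _ (Nat.pos_of_ne_zero ha)]
    simp only [Nat.mul_dvd_mul_iff_left (Nat.pos_of_ne_zero ha)]
  · rw [if_neg h, if_neg fun h' ↦ h (dvd_of_mul_right_dvd h')]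

theorem V_sub (a : ℕ) (f g : ℂ⟦X⟧) : V a (f - g) = V a f - V a g := by
  ext n
  simp only [coeff_V, map_sub]
  split_ifs <;> simp

theorem V_smul (a : ℕ) (c : ℂ) (f : ℂ⟦X⟧) : V a (c • f) = c • V a f := by
  ext n
  simp only [coeff_V, PowerSeries.coeff_smul]
  split_ifs <;> simp

theorem E_mem_range {N k : ℕ} [NeZero N] (hk : 3 ≤ k) (hk2 : Even k) :
    E k ∈ LinearMap.range (qExp N k) := by
  simpa only [V_one] using V_E_mem_range hk hk2 (one_dvd N)

theorem smul_V_E2_sub_mem_range {N d e : ℕ} [NeZero N] (hd : d ∣ N) (he : e ∣ N) :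
    (d : ℂ) • V d (E 2) - (e : ℂ) • V e (E 2) ∈ LinearMap.range (qExp N 2) := by
  have hpos {d : ℕ} (hd : d ∣ N) : 0 < (d : ℚ) := by
    have : d ≠ 0 := by rintro rfl; exact NeZero.ne N (zero_dvd_iff.mp hd)
    exact_mod_cast Nat.pos_of_ne_zero this
  obtain ⟨g, hg⟩ := exists_modularForm_E2_sub (conjugatesGamma0_dilation (hpos hd) hd)
    (conjugatesGamma0_dilation (hpos he) he)
  have h := (hasQSeries_E2.slash_dilation 2 (hpos hd)).sub
    (hasQSeries_E2.slash_dilation 2 (hpos he))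
  rw [← hg] at h
  simpa [show (2 : ℤ) - 1 = 1 from rfl] using mem_range_qExp (f := g) h

theorem V_eisC_mem_range {N h L : ℕ} [NeZero L] (hL : h * N ∣ L) :
    V h (eisC N) ∈ LinearMap.range (qExp L 2) := by
  have hh : h ≠ 0 := by
    rintro rfl
    exact NeZero.ne L (zero_dvd_iff.mp (by simpa using hL))
  have hhC : (h : ℂ) ≠ 0 := by exact_mod_cast hh
  have := smul_V_E2_sub_mem_range (N := L) hL (dvd_of_mul_right_dvd hL)
  rw [eisC, V_smul, V_sub, V_smul, V_V hh]
  refine Submodule.smul_mem _ _ ((Submodule.smul_mem_iff _ hhC).mp ?_)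
  convert this using 1
  rw [smul_sub, smul_smul, Nat.cast_mul]

theorem eisC_mem_range {N L : ℕ} [NeZero L] (hL : N ∣ L) :
    eisC N ∈ LinearMap.range (qExp L 2) := by
  simpa only [V_one] using V_eisC_mem_range (h := 1) (by simpa using hL)

theorem alphaPrime_mem_range {p : ℕ} [NeZero p] : alphaPrime p ∈ LinearMap.range (qExp p 4) :=
  Submodule.smul_mem _ _ (sub_mem (E_mem_range (by norm_num) (by decide))
    (V_E_mem_range (by norm_num) (by decide) dvd_rfl))

/-- Twisting by `ρ` amounts to multiplying coefficients by `ω ^ n - ω ^ (2 n)`, which up to the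
factor `ω - ω²` is `ρ(n)`; as `ρ² = 1` away from `3`, the divisor sums are those of `E₂`. -/
theorem coeff_EChar_rho3 {ω : ℂ} (hω : IsPrimitiveRoot ω 3) (n : ℕ) :
    (-24 * (ω - ω ^ 2)) * PowerSeries.coeff n (EChar rho3) =
      (ω ^ n - (ω ^ 2) ^ n) * PowerSeries.coeff n (E 2) := by
  have h3 : ω ^ 3 = 1 := hω.pow_eq_one
  rcases eq_or_ne n 0 with rfl | hn
  · simp [EChar]
  simp only [EChar, E, PowerSeries.coeff_mk, if_neg hn, bernoulli_two_eq]
  have hr0 : rho3 (0 : ZMod 3) = 0 := by simp [rho3]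
  have hr1 : rho3 (1 : ZMod 3) = 1 := by simp [rho3]
  have hr2 : rho3 (2 : ZMod 3) = -1 := by
    rw [rho3, MulChar.ringHomComp_apply, show quadraticChar (ZMod 3) 2 = -1 by decide]
    simp
  have hsig (h : ¬ 3 ∣ n) : sigmaChar (rho3 ^ 2) n = (ArithmeticFunction.sigma 1 n : ℂ) := by
    rw [sigmaChar, ArithmeticFunction.sigma_one_apply, Nat.cast_sum]
    refine Finset.sum_congr rfl fun d hd ↦ ?_
    have hd3 : (d : ZMod 3) ≠ 0 := by
      rw [ne_eq, ZMod.natCast_eq_zero_iff]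
      exact fun h' ↦ h (h'.trans (Nat.dvd_of_mem_divisors hd))
    have h12 : (d : ZMod 3) = 1 ∨ (d : ZMod 3) = 2 := by
      generalize (d : ZMod 3) = x at *
      decide +revert
    rw [MulChar.pow_apply' _ two_ne_zero]
    rcases h12 with h | h <;> simp [h, hr1, hr2]
  have hpow (m r : ℕ) : ω ^ (3 * m + r) = ω ^ r := by rw [pow_add, pow_mul, h3, one_pow, one_mul]
  obtain ⟨m, r, hr, rfl⟩ : ∃ m r, r < 3 ∧ n = 3 * m + r := ⟨n / 3, n % 3, by omega, by omega⟩
  have hcast : ((3 * m + r : ℕ) : ZMod 3) = r := by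
    push_cast
    rw [show (3 : ZMod 3) = 0 from rfl]
    ring
  rw [hcast, pow_right_comm ω 2, hpow]
  interval_cases r
  · simp [hr0]
  · rw [hsig (by omega)]
    simp [hr1]
    ring
  · rw [hsig (by omega)]
    simp [hr2]
    linear_combination (-24 * (ArithmeticFunction.sigma 1 (3 * m + 2) : ℂ) * ω) * h3

theorem twist_ne_zero {ω : ℂ} (hω : IsPrimitiveRoot ω 3) : -24 * (ω - ω ^ 2) ≠ 0 := by
  rw [show -24 * (ω - ω ^ 2) = 24 * ω * (ω - 1) by ring]
  exact mul_ne_zero (mul_ne_zero (by norm_num) (hω.ne_zero (by norm_num)))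
    (sub_ne_zero.mpr (hω.ne_one (by norm_num)))

theorem EChar_rho3_mem_range : EChar rho3 ∈ LinearMap.range (qExp 9 2) := by
  let ω : ℂ := Complex.exp (2 * Real.pi * Complex.I / (3 : ℕ))
  have hω : IsPrimitiveRoot ω 3 := Complex.isPrimitiveRoot_exp 3 (by norm_num)
  have hne : -24 * (ω - ω ^ 2) ≠ 0 := twist_ne_zero hω
  obtain ⟨g, hg⟩ := exists_modularForm_E2_sub (conjugatesGamma0_translation 1)
    (conjugatesGamma0_translation 2)
  have h := (hasQSeries_E2.slash_translation 2 ((1 : ℤ) / 3)).sub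
    (hasQSeries_E2.slash_translation 2 ((2 : ℤ) / 3))
  rw [← hg] at h
  refine (Submodule.smul_mem_iff _ hne).mp ?_
  convert mem_range_qExp (f := g) h using 1
  have e1 : Complex.exp (2 * Real.pi * Complex.I * ((1 : ℤ) / 3 : ℚ)) = ω := by
    congr 1; push_cast; ring
  have e2 : Complex.exp (2 * Real.pi * Complex.I * ((2 : ℤ) / 3 : ℚ)) = ω ^ 2 := by
    rw [← Complex.exp_nat_mul]
    congr 1; push_cast; ring
  ext n
  rw [e1, e2, map_sub, PowerSeries.coeff_mk, PowerSeries.coeff_mk, PowerSeries.coeff_smul,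
    smul_eq_mul, coeff_EChar_rho3 hω]
  ring

/-! ### Modularity of the generators -/

theorem beta3_mem_range : beta3 ∈ LinearMap.range (qExp 3 6) :=
  Submodule.smul_mem _ _ (sub_mem (Submodule.smul_mem _ _ (sub_mem
    (V_E_mem_range (by norm_num) (by decide) dvd_rfl) (E_mem_range (by norm_num) (by decide))))
    (mul_mem_range_qExp (eisC_mem_range dvd_rfl) alphaPrime_mem_range rfl))

theorem beta5_mem_range : beta5 ∈ LinearMap.range (qExp 5 4) := by
  refine Submodule.smul_mem _ _ (add_mem (add_mem (neg_mem ?_)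
    (Submodule.smul_mem _ _ alphaPrime_mem_range))
    (V_E_mem_range (by norm_num) (by decide) dvd_rfl))
  rw [sq]
  exact mul_mem_range_qExp (eisC_mem_range dvd_rfl) (eisC_mem_range dvd_rfl) rfl

theorem alpha6_mem_range : alpha6 ∈ LinearMap.range (qExp 6 2) :=
  Submodule.smul_mem _ _ (sub_mem (eisC_mem_range (by norm_num)) (eisC_mem_range (by norm_num)))

theorem beta6_mem_range : beta6 ∈ LinearMap.range (qExp 6 2) :=
  Submodule.smul_mem _ _ (sub_mem (V_eisC_mem_range (by norm_num)) (V_eisC_mem_range (by norm_num)))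

theorem alpha4_mem_range : alpha4 ∈ LinearMap.range (qExp 8 2) :=
  Submodule.smul_mem _ _ (sub_mem (eisC_mem_range (by norm_num)) (eisC_mem_range (by norm_num)))

theorem V_alpha4_mem_range : V 2 alpha4 ∈ LinearMap.range (qExp 8 2) := by
  rw [alpha4, V_smul, V_sub]
  exact Submodule.smul_mem _ _
    (sub_mem (V_eisC_mem_range (by norm_num)) (V_eisC_mem_range (by norm_num)))

theorem beta9_mem_range : beta9 ∈ LinearMap.range (qExp 9 2) :=
  Submodule.smul_mem _ _ (sub_mem (Submodule.smul_mem _ _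
    (sub_mem (eisC_mem_range (by norm_num)) (eisC_mem_range (by norm_num)))) EChar_rho3_mem_range)

theorem alpha9_mem_range : alpha9 ∈ LinearMap.range (qExp 9 2) :=
  add_mem EChar_rho3_mem_range (Submodule.smul_mem _ _ beta9_mem_range)

end QExpansions

/-! ### Initial coefficients -/

section Coefficients

/-- The series is `a₀ + a₁ q + a₂ q² + a₃ q³ + a₄ q⁴ + O(q⁵)`. -/
structure HasCoeffs (F : ℂ⟦X⟧) (a₀ a₁ a₂ a₃ a₄ : ℂ) : Prop where
  c0 : PowerSeries.coeff 0 F = a₀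
  c1 : PowerSeries.coeff 1 F = a₁
  c2 : PowerSeries.coeff 2 F = a₂
  c3 : PowerSeries.coeff 3 F = a₃
  c4 : PowerSeries.coeff 4 F = a₄

variable {F G : ℂ⟦X⟧} {a₀ a₁ a₂ a₃ a₄ b₀ b₁ b₂ b₃ b₄ : ℂ}

theorem HasCoeffs.add (hF : HasCoeffs F a₀ a₁ a₂ a₃ a₄) (hG : HasCoeffs G b₀ b₁ b₂ b₃ b₄) :
    HasCoeffs (F + G) (a₀ + b₀) (a₁ + b₁) (a₂ + b₂) (a₃ + b₃) (a₄ + b₄) := by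
  constructor <;> simp only [map_add, hF.c0, hF.c1, hF.c2, hF.c3, hF.c4, hG.c0, hG.c1, hG.c2,
    hG.c3, hG.c4]

theorem HasCoeffs.sub (hF : HasCoeffs F a₀ a₁ a₂ a₃ a₄) (hG : HasCoeffs G b₀ b₁ b₂ b₃ b₄) :
    HasCoeffs (F - G) (a₀ - b₀) (a₁ - b₁) (a₂ - b₂) (a₃ - b₃) (a₄ - b₄) := by
  constructor <;> simp only [map_sub, hF.c0, hF.c1, hF.c2, hF.c3, hF.c4, hG.c0, hG.c1, hG.c2,
    hG.c3, hG.c4]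

theorem HasCoeffs.neg (hF : HasCoeffs F a₀ a₁ a₂ a₃ a₄) :
    HasCoeffs (-F) (-a₀) (-a₁) (-a₂) (-a₃) (-a₄) := by
  constructor <;> simp only [map_neg, hF.c0, hF.c1, hF.c2, hF.c3, hF.c4]

theorem HasCoeffs.smul (c : ℂ) (hF : HasCoeffs F a₀ a₁ a₂ a₃ a₄) :
    HasCoeffs (c • F) (c * a₀) (c * a₁) (c * a₂) (c * a₃) (c * a₄) := by
  constructor <;> simp only [PowerSeries.coeff_smul, smul_eq_mul, hF.c0, hF.c1, hF.c2, hF.c3, hF.c4]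

theorem HasCoeffs.mul (hF : HasCoeffs F a₀ a₁ a₂ a₃ a₄) (hG : HasCoeffs G b₀ b₁ b₂ b₃ b₄) :
    HasCoeffs (F * G) (a₀ * b₀) (a₀ * b₁ + a₁ * b₀) (a₀ * b₂ + a₁ * b₁ + a₂ * b₀)
      (a₀ * b₃ + a₁ * b₂ + a₂ * b₁ + a₃ * b₀)
      (a₀ * b₄ + a₁ * b₃ + a₂ * b₂ + a₃ * b₁ + a₄ * b₀) := by
  constructor <;> simp only [PowerSeries.coeff_mul,
    Finset.Nat.sum_antidiagonal_eq_sum_range_succ_mk, Finset.sum_range_succ, Finset.range_zero,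
    Finset.sum_empty, zero_add, Nat.reduceSub, hF.c0, hF.c1, hF.c2, hF.c3, hF.c4, hG.c0, hG.c1,
    hG.c2, hG.c3, hG.c4]

theorem HasCoeffs.V_two (hF : HasCoeffs F a₀ a₁ a₂ a₃ a₄) : HasCoeffs (V 2 F) a₀ 0 a₁ 0 a₂ := by
  constructor <;> simp [coeff_V, -PowerSeries.coeff_zero_eq_constantCoeff, hF.c0, hF.c1, hF.c2]

theorem HasCoeffs.V_three (hF : HasCoeffs F a₀ a₁ a₂ a₃ a₄) : HasCoeffs (V 3 F) a₀ 0 0 a₁ 0 := by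
  constructor <;> simp [coeff_V, -PowerSeries.coeff_zero_eq_constantCoeff, hF.c0, hF.c1]

theorem HasCoeffs.V_four (hF : HasCoeffs F a₀ a₁ a₂ a₃ a₄) : HasCoeffs (V 4 F) a₀ 0 0 0 a₁ := by
  constructor <;> simp [coeff_V, -PowerSeries.coeff_zero_eq_constantCoeff, hF.c0, hF.c1]

theorem HasCoeffs.V_of_five_le {h : ℕ} (hh : 5 ≤ h) (hF : HasCoeffs F a₀ a₁ a₂ a₃ a₄) :
    HasCoeffs (V h F) a₀ 0 0 0 0 := by
  have hn {n : ℕ} (h0 : 0 < n) (h4 : n < 5) : ¬ h ∣ n := fun hd ↦ by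
    have := Nat.le_of_dvd h0 hd
    omega
  constructor <;> rw [coeff_V]
  · rw [if_pos (dvd_zero h), Nat.zero_div, hF.c0]
  all_goals exact if_neg (hn (by norm_num) (by norm_num))

theorem sigma_values (k : ℕ) : ArithmeticFunction.sigma k 1 = 1 ∧
    ArithmeticFunction.sigma k 2 = 1 + 2 ^ k ∧ ArithmeticFunction.sigma k 3 = 1 + 3 ^ k ∧
    ArithmeticFunction.sigma k 4 = 1 + 2 ^ k + 4 ^ k := by
  refine ⟨?_, ?_, ?_, ?_⟩ <;> rw [ArithmeticFunction.sigma_apply]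
  · simp
  · simp [show Nat.divisors 2 = {1, 2} by decide]
  · simp [show Nat.divisors 3 = {1, 3} by decide]
  · simp [show Nat.divisors 4 = {1, 2, 4} by decide, add_assoc]

theorem hasCoeffs_E2 : HasCoeffs (E 2) 1 (-24) (-72) (-96) (-168) := by
  obtain ⟨h1, h2, h3, h4⟩ := sigma_values (2 - 1)
  constructor <;> simp only [E, PowerSeries.coeff_mk, bernoulli_two_eq, h1, h2, h3, h4] <;> norm_num

theorem hasCoeffs_E4 : HasCoeffs (E 4) 1 240 2160 6720 17520 := by
  obtain ⟨h1, h2, h3, h4⟩ := sigma_values (4 - 1)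
  constructor <;> simp only [E, PowerSeries.coeff_mk, bernoulli_four_eq, h1, h2, h3, h4] <;>
    norm_num

theorem hasCoeffs_E6 : HasCoeffs (E 6) 1 (-504) (-16632) (-122976) (-532728) := by
  obtain ⟨h1, h2, h3, h4⟩ := sigma_values (6 - 1)
  constructor <;> simp only [E, PowerSeries.coeff_mk, bernoulli_six_eq, h1, h2, h3, h4] <;> norm_num

theorem HasCoeffs.congr {a₀' a₁' a₂' a₃' a₄' : ℂ} (hF : HasCoeffs F a₀ a₁ a₂ a₃ a₄)
    (h0 : a₀ = a₀') (h1 : a₁ = a₁') (h2 : a₂ = a₂') (h3 : a₃ = a₃') (h4 : a₄ = a₄') :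
    HasCoeffs F a₀' a₁' a₂' a₃' a₄' := by
  subst h0 h1 h2 h3 h4
  exact hF

theorem hasCoeffs_eisC_two : HasCoeffs (eisC 2) 1 24 24 96 24 := by
  apply ((((hasCoeffs_E2.V_two).smul _).sub hasCoeffs_E2).smul _).congr <;> norm_num

theorem hasCoeffs_eisC_three : HasCoeffs (eisC 3) 1 12 36 12 84 := by
  apply ((((hasCoeffs_E2.V_three).smul _).sub hasCoeffs_E2).smul _).congr <;> norm_num

theorem hasCoeffs_eisC_four : HasCoeffs (eisC 4) 1 8 24 32 24 := by
  apply ((((hasCoeffs_E2.V_four).smul _).sub hasCoeffs_E2).smul _).congr <;> norm_num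

theorem hasCoeffs_eisC_five : HasCoeffs (eisC 5) 1 6 18 24 42 := by
  apply ((((hasCoeffs_E2.V_of_five_le le_rfl).smul _).sub hasCoeffs_E2).smul _).congr <;> norm_num

theorem hasCoeffs_eisC_nine : HasCoeffs (eisC 9) 1 3 9 12 21 := by
  apply ((((hasCoeffs_E2.V_of_five_le (by norm_num)).smul _).sub hasCoeffs_E2).smul _).congr <;>
    norm_num

theorem hasCoeffs_alpha3 : HasCoeffs alpha3 0 1 9 27 73 := by
  apply ((hasCoeffs_E4.sub hasCoeffs_E4.V_three).smul _).congr <;> norm_num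

theorem hasCoeffs_beta3 : HasCoeffs beta3 0 0 1 6 27 := by
  apply ((((hasCoeffs_E6.V_three.sub hasCoeffs_E6).smul _).sub
    (hasCoeffs_eisC_three.mul hasCoeffs_alpha3)).smul _).congr <;> norm_num

theorem hasCoeffs_alpha5 : HasCoeffs alpha5 0 1 9 28 73 := by
  apply ((hasCoeffs_E4.sub (hasCoeffs_E4.V_of_five_le le_rfl)).smul _).congr <;> norm_num

theorem hasCoeffs_beta5 : HasCoeffs beta5 0 0 1 2 5 := by
  rw [beta5, sq]
  apply ((((hasCoeffs_eisC_five.mul hasCoeffs_eisC_five).neg.add (hasCoeffs_alpha5.smul _)).add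
    (hasCoeffs_E4.V_of_five_le le_rfl)).smul _).congr <;> norm_num

theorem hasCoeffs_alpha6 : HasCoeffs alpha6 0 1 (-1) 7 (-5) := by
  apply ((hasCoeffs_eisC_two.sub hasCoeffs_eisC_three).smul _).congr <;> norm_num

theorem hasCoeffs_beta6 : HasCoeffs beta6 0 0 1 (-2) 3 := by
  apply ((hasCoeffs_eisC_three.V_two.sub hasCoeffs_eisC_two.V_three).smul _).congr <;> norm_num

theorem hasCoeffs_alpha4 : HasCoeffs alpha4 0 1 0 4 0 := by
  apply ((hasCoeffs_eisC_two.sub hasCoeffs_eisC_four).smul _).congr <;> norm_num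

theorem hasCoeffs_EChar_rho3 : HasCoeffs (EChar rho3) 0 1 (-3) 0 7 := by
  let ω : ℂ := Complex.exp (2 * Real.pi * Complex.I / (3 : ℕ))
  have hω : IsPrimitiveRoot ω 3 := Complex.isPrimitiveRoot_exp 3 (by norm_num)
  have h3 : ω ^ 3 = 1 := hω.pow_eq_one
  have hne : -24 * (ω - ω ^ 2) ≠ 0 := twist_ne_zero hω
  have key (n : ℕ) := coeff_EChar_rho3 hω n
  obtain ⟨e0, e1, e2, e3, e4⟩ := hasCoeffs_E2
  constructor <;> refine mul_left_cancel₀ hne ?_ <;> rw [key]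
  · rw [e0]; ring
  · rw [e1]; ring
  · rw [e2]; linear_combination 72 * ω * h3
  · rw [e3]; linear_combination (96 * ω ^ 3) * h3
  · rw [e4]; linear_combination (-168 * ω + 168 * ω ^ 2 * (ω ^ 3 + 1)) * h3

theorem hasCoeffs_beta9 : HasCoeffs beta9 0 0 1 0 0 := by
  apply ((((hasCoeffs_eisC_three.sub hasCoeffs_eisC_nine).smul _).sub
    hasCoeffs_EChar_rho3).smul _).congr <;> norm_num

theorem hasCoeffs_alpha9 : HasCoeffs alpha9 0 1 6 0 7 := by
  apply (hasCoeffs_EChar_rho3.add (hasCoeffs_beta9.smul _)).congr <;> norm_num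

end Coefficients

/-! ### The five presentations -/

section Relations

open MvPolynomial

theorem hasLeadingTerms_of_hasCoeffs {F : Fin 3 → ℂ⟦X⟧} {a₁ a₂ a₃ a₄ b₂ b₃ b₄ c₃ c₄ : ℂ}
    (h0 : HasCoeffs (F 0) 1 a₁ a₂ a₃ a₄) (h1 : HasCoeffs (F 1) 0 1 b₂ b₃ b₄)
    (h2 : HasCoeffs (F 2) 0 0 1 c₃ c₄) : HasLeadingTerms F := by
  refine ⟨h0.c0, ?_, ?_⟩
  · obtain ⟨G, hG⟩ := PowerSeries.X_dvd_iff.mpr (by simpa using h1.c0)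
    refine ⟨G, hG, ?_⟩
    have := h1.c1
    rwa [hG, show 1 = 0 + 1 from rfl, PowerSeries.coeff_succ_X_mul] at this
  · obtain ⟨G, hG⟩ := (PowerSeries.X_pow_dvd_iff (n := 2)).mpr fun m hm ↦ by
      interval_cases m
      exacts [h2.c0, h2.c1]
    refine ⟨G, hG, ?_⟩
    have := h2.c2
    rwa [hG, PowerSeries.coeff_X_pow_mul', if_pos le_rfl] at this

theorem HasCoeffs.coeff_eq_zero {F : ℂ⟦X⟧} (h : HasCoeffs F 0 0 0 0 0) {n : ℕ} (hn : n ≤ 4) :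
    PowerSeries.coeff n F = 0 := by
  interval_cases n
  exacts [h.c0, h.c1, h.c2, h.c3, h.c4]

theorem stdOrder_le_four {s : StdIndex} (hs : stdWeight ![2, 2, 2] s = 4) : stdOrder s ≤ 4 := by
  simp [stdWeight] at hs
  simp only [stdOrder]
  omega

theorem mul_X_one_sq_sub_quadric_mem_stdSpan (a b : ℕ) :
    (X 0 ^ a * X 2 ^ b * (X 1 ^ 2 - (X 1 ^ 2 - X 0 * X 2)) : MvPolynomial (Fin 3) ℂ) ∈
      stdSpan := by
  convert stdMonomial_mem_stdSpan (a + 1) 0 (b + 1) using 1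
  simp only [Fin.val_zero]
  ring

/-- The presentation at the levels where the relation is the quadric `X₁² = X₀ X₂`. -/
theorem hasGradedPresentation_quadric {N k : ℕ} {w : Fin 3 → ℕ} {F : Fin 3 → ℂ⟦X⟧}
    {a₁ a₂ a₃ a₄ b₂ b₃ b₄ c₃ c₄ : ℂ} (hw0 : 0 < w 0) (hw1 : 1 ≤ w 1) (hw2 : 2 ≤ w 2)
    (hk : 2 * w 1 = k) (hk' : w 0 + w 2 = k)
    (hF : ∀ i, F i ∈ LinearMap.range (qExp N (w i)))
    (h0 : HasCoeffs (F 0) 1 a₁ a₂ a₃ a₄) (h1 : HasCoeffs (F 1) 0 1 b₂ b₃ b₄)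
    (h2 : HasCoeffs (F 2) 0 0 1 c₃ c₄) (hN : OrdersAreStandard N w)
    (ho : ∀ s, stdWeight w s = k → stdOrder s ≤ 4)
    (hrel : HasCoeffs (F 1 * F 1 - F 0 * F 2) 0 0 0 0 0) :
    HasGradedPresentation N w F (X 1 ^ 2 - X 0 * X 2) := by
  refine hasGradedPresentation_of_ordersAreStandard (kO := k) hw0 hw1 hw2 hF
    (hasLeadingTerms_of_hasCoeffs h0 h1 h2) hN mul_X_one_sq_sub_quadric_mem_stdSpan
    ((weightedHomogeneousSubmodule ℂ w k).sub_mem ?_ ?_) fun s hs ↦ ?_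
  · have := (isWeightedHomogeneous_X ℂ w 1).pow 2
    rwa [smul_eq_mul, hk] at this
  · have := (isWeightedHomogeneous_X ℂ w 0).mul (isWeightedHomogeneous_X ℂ w 2)
    rwa [hk'] at this
  · rw [map_sub, map_mul, map_pow, aeval_X, aeval_X, aeval_X, sq]
    exact hrel.coeff_eq_zero (ho s hs)

theorem hasGradedPresentation_three :
    HasGradedPresentation 3 ![2, 4, 6] ![eisC 3, alpha3, beta3] (X 1 ^ 2 - X 0 * X 2) := by
  refine hasGradedPresentation_quadric (k := 8) (by simp) (by simp) (by simp) (by simp) (by simp)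
    (fun i ↦ ?_) hasCoeffs_eisC_three hasCoeffs_alpha3 hasCoeffs_beta3 ordersAreStandard_three
    (fun s hs ↦ ?_) ?_
  · fin_cases i
    exacts [eisC_mem_range dvd_rfl, alphaPrime_mem_range, beta3_mem_range]
  · simp [stdWeight] at hs
    simp only [stdOrder]
    omega
  · apply ((hasCoeffs_alpha3.mul hasCoeffs_alpha3).sub
      (hasCoeffs_eisC_three.mul hasCoeffs_beta3)).congr <;> norm_num

theorem hasGradedPresentation_five :
    HasGradedPresentation 5 ![2, 4, 4] ![eisC 5, alpha5, beta5]
      (X 1 ^ 2 - (X 0 ^ 2 + 4 * X 1 - 8 * X 2) * X 2) := by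
  refine hasGradedPresentation_of_ordersAreStandard (kO := 8) (by simp) (by simp) (by simp)
    (fun i ↦ ?_) (hasLeadingTerms_of_hasCoeffs hasCoeffs_eisC_five hasCoeffs_alpha5
      hasCoeffs_beta5) ordersAreStandard_five (fun a b ↦ ?_) ?_ fun s hs ↦ ?_
  · fin_cases i
    exacts [eisC_mem_range dvd_rfl, alphaPrime_mem_range, beta5_mem_range]
  · convert sub_mem (add_mem (stdMonomial_mem_stdSpan (a + 2) 0 (b + 1))
      (Submodule.smul_mem _ (4 : ℂ) (stdMonomial_mem_stdSpan a 1 (b + 1))))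
      (Submodule.smul_mem _ (8 : ℂ) (stdMonomial_mem_stdSpan a 0 (b + 2))) using 1
    simp only [Fin.val_zero, Fin.val_one, smul_eq_C_mul, map_ofNat]
    ring
  · have hX (i : Fin 3) := isWeightedHomogeneous_X ℂ (![2, 4, 4] : Fin 3 → ℕ) i
    have hC (c : ℂ) := isWeightedHomogeneous_C (![2, 4, 4] : Fin 3 → ℕ) c
    have h4 : IsWeightedHomogeneous (![2, 4, 4] : Fin 3 → ℕ)
        (X 0 ^ 2 + 4 * X 1 - 8 * X 2 : MvPolynomial (Fin 3) ℂ) 4 :=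
      (weightedHomogeneousSubmodule ℂ (![2, 4, 4] : Fin 3 → ℕ) 4).sub_mem
        ((weightedHomogeneousSubmodule ℂ (![2, 4, 4] : Fin 3 → ℕ) 4).add_mem
          ((hX 0).pow 2) ((hC 4).mul (hX 1))) ((hC 8).mul (hX 2))
    exact (weightedHomogeneousSubmodule ℂ (![2, 4, 4] : Fin 3 → ℕ) 8).sub_mem
      ((hX 1).pow 2) (h4.mul (hX 2))
  · have hs4 : stdOrder s ≤ 4 := by
      simp [stdWeight] at hs
      simp only [stdOrder]
      omega
    have h4 : aeval ![eisC 5, alpha5, beta5] (4 : MvPolynomial (Fin 3) ℂ) = (4 : ℂ) • 1 := by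
      rw [map_ofNat, Algebra.smul_def, map_ofNat, mul_one]
    have h8 : aeval ![eisC 5, alpha5, beta5] (8 : MvPolynomial (Fin 3) ℂ) = (8 : ℂ) • 1 := by
      rw [map_ofNat, Algebra.smul_def, map_ofNat, mul_one]
    simp only [map_sub, map_mul, map_add, aeval_X, h4, h8, smul_one_mul, sq]
    rw [← map_sub]
    refine HasCoeffs.coeff_eq_zero ?_ hs4
    apply ((hasCoeffs_alpha5.mul hasCoeffs_alpha5).sub
      ((((hasCoeffs_eisC_five.mul hasCoeffs_eisC_five).add (hasCoeffs_alpha5.smul 4)).sub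
        (hasCoeffs_beta5.smul 8)).mul hasCoeffs_beta5)).congr <;> norm_num

theorem hasGradedPresentation_six :
    HasGradedPresentation 6 ![2, 2, 2] ![V 2 (eisC 3), alpha6, beta6] (X 1 ^ 2 - X 0 * X 2) := by
  refine hasGradedPresentation_quadric (k := 4) (by simp) (by simp) (by simp) (by simp) (by simp)
    (fun i ↦ ?_) hasCoeffs_eisC_three.V_two hasCoeffs_alpha6 hasCoeffs_beta6
    (ordersAreStandard_of_index_le index_Gamma0_six_le) (fun s ↦ stdOrder_le_four) ?_
  · fin_cases i
    exacts [V_eisC_mem_range dvd_rfl, alpha6_mem_range, beta6_mem_range]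
  · apply ((hasCoeffs_alpha6.mul hasCoeffs_alpha6).sub
      (hasCoeffs_eisC_three.V_two.mul hasCoeffs_beta6)).congr <;> norm_num

theorem hasGradedPresentation_eight :
    HasGradedPresentation 8 ![2, 2, 2] ![V 2 (eisC 4), alpha4, V 2 alpha4]
      (X 1 ^ 2 - X 0 * X 2) := by
  refine hasGradedPresentation_quadric (k := 4) (by simp) (by simp) (by simp) (by simp) (by simp)
    (fun i ↦ ?_) hasCoeffs_eisC_four.V_two hasCoeffs_alpha4 hasCoeffs_alpha4.V_two
    (ordersAreStandard_of_index_le index_Gamma0_eight_le) (fun s ↦ stdOrder_le_four) ?_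
  · fin_cases i
    exacts [V_eisC_mem_range dvd_rfl, alpha4_mem_range, V_alpha4_mem_range]
  · apply ((hasCoeffs_alpha4.mul hasCoeffs_alpha4).sub
      (hasCoeffs_eisC_four.V_two.mul hasCoeffs_alpha4.V_two)).congr <;> norm_num

theorem hasGradedPresentation_nine :
    HasGradedPresentation 9 ![2, 2, 2] ![eisC 3, alpha9, beta9] (X 1 ^ 2 - X 0 * X 2) := by
  refine hasGradedPresentation_quadric (k := 4) (by simp) (by simp) (by simp) (by simp) (by simp)
    (fun i ↦ ?_) hasCoeffs_eisC_three hasCoeffs_alpha9 hasCoeffs_beta9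
    (ordersAreStandard_of_index_le index_Gamma0_nine_le) (fun s ↦ stdOrder_le_four) ?_
  · fin_cases i
    exacts [eisC_mem_range (by norm_num), alpha9_mem_range, beta9_mem_range]
  · apply ((hasCoeffs_alpha9.mul hasCoeffs_alpha9).sub
      (hasCoeffs_eisC_three.mul hasCoeffs_beta9)).congr <;> norm_num

end Relations

end

end SmallLevel

open MvPolynomial SmallLevel in
theorem theorem2 :
    HasGradedPresentation 3 ![2, 4, 6] ![eisC 3, alpha3, beta3]
      (X 1 ^ 2 - X 0 * X 2) ∧
    HasGradedPresentation 5 ![2, 4, 4] ![eisC 5, alpha5, beta5]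
      (X 1 ^ 2 - (X 0 ^ 2 + 4 * X 1 - 8 * X 2) * X 2) ∧
    HasGradedPresentation 6 ![2, 2, 2] ![V 2 (eisC 3), alpha6, beta6]
      (X 1 ^ 2 - X 0 * X 2) ∧
    HasGradedPresentation 8 ![2, 2, 2] ![V 2 (eisC 4), alpha4, V 2 alpha4]
      (X 1 ^ 2 - X 0 * X 2) ∧
    HasGradedPresentation 9 ![2, 2, 2] ![eisC 3, alpha9, beta9]
      (X 1 ^ 2 - X 0 * X 2) := by
  exact ⟨hasGradedPresentation_three, hasGradedPresentation_five, hasGradedPresentation_six,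
    hasGradedPresentation_eight, hasGradedPresentation_nine⟩
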